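/- Let $\mathbf{k}$ be an algebraically closed field of characteristic $0$, let $m\ge 2$, and let $A\in \mathrm{SL}_{m+1}(\mathbf{k})$ be a matrix of infinite order, viewed as an automorphism of $\mathbb{P}^m_{\mathbf{k}}$ and hence as an element of the Cremona group $\mathrm{Bir}(\mathbb{P}^m_{\mathbf{k}})$. Then the distortion type of $A$ in $\mathrm{Bir}(\mathbb{P}^m_{\mathbf{k}})$ is $\exp(\exp(n))$ (doubly exponential) if $A$ is virtually unipotent, i.e. if some power $A^r$ with $r\ge 1$ is unipotent, and it is $\exp(n)$ (simply exponential) otherwise. Here, for functions $f,g\colon \mathbf{R}_+\to[0,\infty]$, write $f\preceq g$ if there are constants $C,C',C''>0$ with $f(x)\le C\,g(C'x)+C''$ for all $x\ge 0$. If $c$ is an element of a group $G$ and $H\subset G$ is a finitely generated subgroup containing $c$, choose a finite symmetric generating set $S$ of $H$ with $1\in S$, and let $\delta_c^H(n)=\sup\{i\in\mathbf{N} : c^i\in S^n\}$, extended to real $x\ge 0$ by $\delta_c^H(x)=\delta_c^H(\lfloor x\rfloor)$; up to $\preceq$ in both directions it does not depend on $S$. The distortion type of $c$ in $G$ is $f$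 if $f\preceq\delta_c^H$ for some finitely generated subgroup $H$ of $G$ containing $c$, and $\delta_c^H\preceq f$ for every finitely generated subgroup $H$ of $G$ containing $c$. -/

import Mathlib

open scoped Pointwise NNReal ENNReal

noncomputable section

/-! ### Comparison of functions and distortion in groups -/

namespace Distortion

/-- `f ≼ g` : there are positive constants `C, C', C''` with `f x ≤ C * g (C' * x) + C''` for all
`x ≥ 0`. Functions take values in `[0, ∞]`, because a distortion function may be infinite. -/
def Dominated (f g : ℝ≥0 → ℝ≥0∞) : Prop :=
  ∃ C C' C'' : ℝ≥0, 0 < C ∧ 0 < C' ∧ 0 < C'' ∧ ∀ x : ℝ≥0, f x ≤ C * g (C' * x) + C''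

/-- The function `x ↦ exp x`. -/
def expFun (x : ℝ≥0) : ℝ≥0∞ := ENNReal.ofReal (Real.exp x)

/-- The function `x ↦ exp (exp x)`. -/
def expExpFun (x : ℝ≥0) : ℝ≥0∞ := ENNReal.ofReal (Real.exp (Real.exp x))

variable {G : Type*} [Group G]

/-- `S` is a finite symmetric subset of `G` containing `1` and generating the subgroup `H`. -/
structure IsGeneratingSet (S : Set G) (H : Subgroup G) : Prop where
  finite : S.Finite
  inv_eq : S⁻¹ = S
  one_mem : 1 ∈ S
  closure_eq : Subgroup.closure S = H

/-- The distortion function `δ_{c,S}(n) = sup {i ∈ ℕ | c ^ i ∈ S ^ n} ∈ [0, ∞]`, where `S ^ n` is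
the set of products of `n` elements of `S`; it is extended to real `x ≥ 0` by `n = ⌊x⌋`. -/
def distortionFun (c : G) (S : Set G) (x : ℝ≥0) : ℝ≥0∞ :=
  ⨆ (i : ℕ) (_ : c ^ i ∈ S ^ ⌊x⌋₊), (i : ℝ≥0∞)

/-- The distortion type of `c` in `G` is at least `f`: `f ≼ δ_c^H` for some finitely generated
subgroup `H` containing `c`. -/
def TypeAtLeast (c : G) (f : ℝ≥0 → ℝ≥0∞) : Prop :=
  ∃ H : Subgroup G, c ∈ H ∧ ∃ S : Set G, IsGeneratingSet S H ∧ Dominated f (distortionFun c S)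

/-- The distortion type of `c` in `G` is at most `g`: `δ_c^H ≼ g` for every finitely generated
subgroup `H` containing `c`. -/
def TypeAtMost (c : G) (g : ℝ≥0 → ℝ≥0∞) : Prop :=
  ∀ H : Subgroup G, c ∈ H → ∀ S : Set G, IsGeneratingSet S H → Dominated (distortionFun c S) g

/-- The distortion type of `c` in `G` is `f`: it is at least `f` and at most `f`. -/
def HasType (c : G) (f : ℝ≥0 → ℝ≥0∞) : Prop :=
  TypeAtLeast c f ∧ TypeAtMost c f

end Distortion

/-! ### The Cremona group `Bir(ℙ^m_k)` in homogeneous coordinates -/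

namespace Cremona

open MvPolynomial

variable {k : Type*} [Field k] {m : ℕ}

variable (k m) in
/-- `(m+1)`-tuples `(F₀, …, F_m)` of polynomials in the variables `x₀, …, x_m`. -/
abbrev Tuple : Type _ := Fin (m + 1) → MvPolynomial (Fin (m + 1)) k

/-- Composition `F ∘ G`, substituting `G` in `F`. -/
def comp (F G : Tuple k m) : Tuple k m := fun i => bind₁ G (F i)

/-- The tuple defines a rational map `[F₀ : … : F_m]` from `ℙ^m` to itself: the `F_i` are
homogeneous of the same degree and not all zero. -/
def IsRational (F : Tuple k m) : Prop :=
  F ≠ 0 ∧ ∃ d : ℕ, ∀ i, (F i).IsHomogeneous d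

/-- `[F₀ : … : F_m] = [G₀ : … : G_m]`, for nonzero tuples. -/
def SameMap (F G : Tuple k m) : Prop := ∀ i j, F i * G j = F j * G i

/-- The rational map `F ∘ G` is defined and is the identity. -/
def IsLeftInverse (F G : Tuple k m) : Prop := comp F G ≠ 0 ∧ SameMap (comp F G) X

/-- The tuple defines a birational transformation of `ℙ^m`. -/
def IsBirational (F : Tuple k m) : Prop :=
  IsRational F ∧ ∃ G : Tuple k m, IsRational G ∧ IsLeftInverse F G ∧ IsLeftInverse G F

theorem comp_assoc (F G H : Tuple k m) : comp (comp F G) H = comp F (comp G H) := by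
  funext i
  exact bind₁_bind₁ _ _ _

theorem comp_X (F : Tuple k m) : comp F X = F := by
  funext i
  simp [comp, bind₁_X_left]

theorem X_comp (F : Tuple k m) : comp X F = F := by
  funext i
  simp [comp]

theorem SameMap.refl (F : Tuple k m) : SameMap F F := fun _ _ => mul_comm _ _

theorem SameMap.symm {F G : Tuple k m} (h : SameMap F G) : SameMap G F := fun i j => by
  rw [mul_comm, mul_comm (G j)]
  exact (h j i)

theorem SameMap.ne_zero {F G : Tuple k m} (h : SameMap F G) (hF : F ≠ 0) {j : Fin (m + 1)}
    (hj : G j ≠ 0) : F j ≠ 0 := by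
  obtain ⟨i, hi⟩ := Function.ne_iff.1 hF
  intro h0
  have := h i j
  rw [h0, zero_mul] at this
  exact (mul_ne_zero hi hj) this

theorem SameMap.trans {F G H : Tuple k m} (hG : G ≠ 0) (h : SameMap F G) (h' : SameMap G H) :
    SameMap F H := by
  obtain ⟨l, hl⟩ := Function.ne_iff.1 hG
  have hl : G l ≠ 0 := hl
  intro i j
  apply mul_left_cancel₀ (mul_ne_zero hl hl)
  linear_combination (G l * H j) * h i l + (F l * G i) * h' l j - (G l * H i) * h j l
    - (F l * G j) * h' l i

theorem bind₁_mul_left {Q : MvPolynomial (Fin (m + 1)) k} {d : ℕ} (hQ : Q.IsHomogeneous d)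
    (a : MvPolynomial (Fin (m + 1)) k) (G : Tuple k m) :
    bind₁ (fun i => a * G i) Q = a ^ d * bind₁ G Q := by
  simp only [bind₁, aeval_def, eval₂_eq', Finset.mul_sum]
  refine Finset.sum_congr rfl fun s hs => ?_
  have hd : ∑ i, s i = d := by
    have := hQ.degree_eq_sum_deg_support hs
    rw [Finset.sum_subset (Finset.subset_univ _)] at this
    · exact this.symm
    · intro i _ hi
      simpa using hi
  simp only [mul_pow, Finset.prod_mul_distrib, Finset.prod_pow_eq_pow_sum, hd]
  ring

theorem SameMap.bind₁_eq {F G : Tuple k m} (h : SameMap F G)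
    {Q : MvPolynomial (Fin (m + 1)) k} {d : ℕ} (hQ : Q.IsHomogeneous d) (j : Fin (m + 1)) :
    G j ^ d * bind₁ F Q = F j ^ d * bind₁ G Q := by
  rw [← bind₁_mul_left hQ, ← bind₁_mul_left hQ]
  congr 2
  funext i
  rw [mul_comm]
  exact h i j

theorem SameMap.comp_right {F F' : Tuple k m} (h : SameMap F F') (G : Tuple k m) :
    SameMap (comp F G) (comp F' G) := fun i j => by
  simpa [comp] using congrArg (bind₁ G) (h i j)

theorem SameMap.comp_left {F G G' : Tuple k m} (hF : IsRational F) (hG' : G' ≠ 0)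
    (h : SameMap G G') : SameMap (comp F G) (comp F G') := by
  obtain ⟨-, d, hd⟩ := hF
  obtain ⟨l, hl⟩ := Function.ne_iff.1 hG'
  have hl : G' l ≠ 0 := hl
  intro i j
  apply mul_left_cancel₀ (pow_ne_zero d hl)
  have h1 := h.bind₁_eq (hd i) l
  have h2 := h.bind₁_eq (hd j) l
  simp only [comp]
  linear_combination (bind₁ G' (F j)) * h1 - (bind₁ G' (F i)) * h2

theorem X_ne_zero' : (X : Tuple k m) ≠ 0 := fun h => X_ne_zero (0 : Fin (m + 1)) (congrFun h 0)

/-- If `G` has a right inverse, then `F ∘ G` is defined for every rational map `F`. -/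
theorem comp_ne_zero {F G H : Tuple k m} (hF : IsRational F) (hG : IsLeftInverse G H) :
    comp F G ≠ 0 := by
  intro h0
  obtain ⟨hne, hs⟩ := hG
  have h1 : comp F (comp G H) = 0 := by
    rw [← comp_assoc, h0]
    funext i
    simp [comp]
  obtain ⟨l, hl⟩ := Function.ne_iff.1 hne
  have hl : comp G H l ≠ 0 := hl
  obtain ⟨hF0, d, hd⟩ := hF
  apply hF0
  funext i
  have h2 := hs.bind₁_eq (hd i) l
  have h3 : bind₁ (comp G H) (F i) = 0 := congrFun h1 i
  rw [h3, mul_zero, bind₁_X_left] at h2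
  rcases mul_eq_zero.1 h2.symm with h | h
  · exact absurd h (pow_ne_zero d hl)
  · exact h

theorem IsRational.comp {F G H : Tuple k m} (hF : IsRational F) (hG : IsRational G)
    (hGH : IsLeftInverse G H) : IsRational (comp F G) := by
  refine ⟨comp_ne_zero hF hGH, ?_⟩
  obtain ⟨d, hd⟩ := hF.2
  obtain ⟨e, he⟩ := hG.2
  exact ⟨e * d, fun i => (hd i).aeval _ he⟩

theorem isRational_X : IsRational (X : Tuple k m) :=
  ⟨X_ne_zero', 1, fun i => isHomogeneous_X k i⟩

theorem isLeftInverse_X : IsLeftInverse (X : Tuple k m) X := by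
  refine ⟨?_, ?_⟩ <;> rw [comp_X]
  · exact X_ne_zero'
  · exact SameMap.refl _

theorem isBirational_X : IsBirational (X : Tuple k m) :=
  ⟨isRational_X, X, isRational_X, isLeftInverse_X, isLeftInverse_X⟩

theorem IsLeftInverse.comp {F F' G G' : Tuple k m} (hF : IsRational F) (hF' : IsRational F')
    (hG : IsRational G) (hG' : IsRational G') (h : IsLeftInverse F F') (h' : IsLeftInverse F' F)
    (hh : IsLeftInverse G G') (hh' : IsLeftInverse G' G) :
    IsLeftInverse (comp F G) (comp G' F') := by
  have h1 : IsRational (Cremona.comp G G') := hG.comp hG' hh'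
  have h2 : Cremona.comp (Cremona.comp G G') F' ≠ 0 := comp_ne_zero h1 h'
  have h3 : SameMap (Cremona.comp (Cremona.comp G G') F') F' := by
    simpa only [X_comp] using hh.2.comp_right F'
  have h4 : Cremona.comp (Cremona.comp F G) (Cremona.comp G' F')
      = Cremona.comp F (Cremona.comp (Cremona.comp G G') F') := by
    simp only [comp_assoc]
  have h5 : Cremona.comp (Cremona.comp F G) (Cremona.comp G' F')
      = Cremona.comp (Cremona.comp (Cremona.comp F G) G') F' := by
    simp only [comp_assoc]
  refine ⟨?_, ?_⟩
  · rw [h5]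
    exact comp_ne_zero ((hF.comp hG hh).comp hG' hh') h'
  · rw [h4]
    exact (SameMap.comp_left hF hF'.1 h3).trans h.1 h.2

theorem IsBirational.comp {F G : Tuple k m} (hF : IsBirational F) (hG : IsBirational G) :
    IsBirational (comp F G) := by
  obtain ⟨hF, F', hF', h, h'⟩ := hF
  obtain ⟨hG, G', hG', hh, hh'⟩ := hG
  exact ⟨hF.comp hG hh, Cremona.comp G' F', hG'.comp hF' h', h.comp hF hF' hG hG' h' hh hh',
    hh'.comp hG' hG hF' hF hh h' h⟩

theorem comp_congr {F F' G G' : Tuple k m} (hF' : IsBirational F')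
    (hG : IsBirational G) (hG' : IsBirational G') (h : SameMap F F') (h' : SameMap G G') :
    SameMap (comp F G) (comp F' G') :=
  (h.comp_right G).trans (hF'.comp hG).1.1 (h'.comp_left hF'.1 hG'.1.1)

variable (k m) in
/-- Two tuples are identified when they define the same rational map. -/
instance birSetoid : Setoid {F : Tuple k m // IsBirational F} where
  r F G := SameMap F.1 G.1
  iseqv :=
    { refl := fun F => SameMap.refl F.1
      symm := fun h => h.symm
      trans := fun {_ G _} h h' => h.trans G.2.1.1 h' }

variable (k m) in
/-- The Cremona group `Bir(ℙ^m_k)`: birational transformations `[F₀ : … : F_m]` of `ℙ^m_k`. -/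
def Bir : Type _ := Quotient (birSetoid k m)

/-- The birational transformation `[F₀ : … : F_m]`. -/
def Bir.mk (F : Tuple k m) (hF : IsBirational F) : Bir k m := Quotient.mk _ ⟨F, hF⟩

theorem Bir.mk_eq_mk {F G : Tuple k m} (hF : IsBirational F) (hG : IsBirational G) :
    Bir.mk F hF = Bir.mk G hG ↔ SameMap F G := Quotient.eq

/-- A tuple defining the inverse birational transformation. -/
def invTuple (F : {F : Tuple k m // IsBirational F}) : Tuple k m := F.2.2.choose

theorem invTuple_spec (F : {F : Tuple k m // IsBirational F}) :
    IsRational (invTuple F) ∧ IsLeftInverse F.1 (invTuple F) ∧ IsLeftInverse (invTuple F) F.1 :=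
  F.2.2.choose_spec

theorem isBirational_invTuple (F : {F : Tuple k m // IsBirational F}) :
    IsBirational (invTuple F) :=
  ⟨(invTuple_spec F).1, F.1, F.2.1, (invTuple_spec F).2.2, (invTuple_spec F).2.1⟩

theorem invTuple_congr (F G : {F : Tuple k m // IsBirational F}) (h : SameMap F.1 G.1) :
    SameMap (invTuple F) (invTuple G) := by
  have hF := isBirational_invTuple F
  have hG := isBirational_invTuple G
  have e1 : SameMap (invTuple F) (comp (invTuple F) (comp G.1 (invTuple G))) := by
    have := SameMap.comp_left hF.1 X_ne_zero' (invTuple_spec G).2.1.2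
    rw [comp_X] at this
    exact this.symm
  have e2 : SameMap (comp (comp (invTuple F) F.1) (invTuple G)) (invTuple G) := by
    simpa only [X_comp] using (invTuple_spec F).2.2.2.comp_right (invTuple G)
  have e3 : SameMap (comp (invTuple F) (comp G.1 (invTuple G)))
      (comp (comp (invTuple F) F.1) (invTuple G)) := by
    rw [comp_assoc]
    exact SameMap.comp_left hF.1 (F.2.comp hG).1.1
      (h.symm.comp_right (invTuple G))
  exact (e1.trans (hF.comp (G.2.comp hG)).1.1 e3).trans ((hF.comp F.2).comp hG).1.1 e2

/-- The group law is the composition of birational transformations. -/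
instance : Group (Bir k m) where
  mul := Quotient.map₂ (fun F G => ⟨comp F.1 G.1, F.2.comp G.2⟩)
    (fun F F' h G G' h' => comp_congr F'.2 G.2 G'.2 h h')
  one := Bir.mk X isBirational_X
  inv := Quotient.map (fun F => ⟨invTuple F, isBirational_invTuple F⟩) invTuple_congr
  mul_assoc := by
    rintro ⟨F⟩ ⟨G⟩ ⟨H⟩
    exact congrArg (Quotient.mk _) (Subtype.ext (comp_assoc F.1 G.1 H.1))
  one_mul := by
    rintro ⟨F⟩
    exact congrArg (Quotient.mk _) (Subtype.ext (X_comp F.1))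
  mul_one := by
    rintro ⟨F⟩
    exact congrArg (Quotient.mk _) (Subtype.ext (comp_X F.1))
  inv_mul_cancel := by
    rintro ⟨F⟩
    exact Quotient.sound (invTuple_spec F).2.2.2

theorem Bir.mk_mul_mk {F G : Tuple k m} (hF : IsBirational F) (hG : IsBirational G) :
    Bir.mk F hF * Bir.mk G hG = Bir.mk (comp F G) (hF.comp hG) := rfl

theorem Bir.one_def : (1 : Bir k m) = Bir.mk X isBirational_X := rfl

/-- The linear tuple `x ↦ A x`, that is `F_i = ∑ j, A i j * x_j`. -/
def linearTuple (A : Matrix (Fin (m + 1)) (Fin (m + 1)) k) : Tuple k m :=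
  fun i => ∑ j, C (A i j) * X j

theorem linearTuple_one : linearTuple (1 : Matrix (Fin (m + 1)) (Fin (m + 1)) k) = X := by
  funext i
  simp [linearTuple, Matrix.one_apply]

theorem comp_linearTuple (A B : Matrix (Fin (m + 1)) (Fin (m + 1)) k) :
    comp (linearTuple A) (linearTuple B) = linearTuple (A * B) := by
  funext i
  simp only [comp, linearTuple, map_sum, map_mul, bind₁_X_right, Matrix.mul_apply,
    algHom_C, algebraMap_eq, Finset.mul_sum, Finset.sum_mul]
  rw [Finset.sum_comm]
  simp only [mul_assoc]

theorem isRational_linearTuple {A B : Matrix (Fin (m + 1)) (Fin (m + 1)) k} (h : A * B = 1) :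
    IsRational (linearTuple A) := by
  refine ⟨fun h0 => ?_, 1, fun i => ?_⟩
  · apply X_ne_zero' (k := k) (m := m)
    rw [← linearTuple_one, ← h, ← comp_linearTuple, h0]
    funext i
    simp [comp]
  · exact IsHomogeneous.sum _ _ _ fun j _ => isHomogeneous_C_mul_X _ _

theorem isLeftInverse_linearTuple {A B : Matrix (Fin (m + 1)) (Fin (m + 1)) k} (h : A * B = 1) :
    IsLeftInverse (linearTuple A) (linearTuple B) := by
  unfold IsLeftInverse
  rw [comp_linearTuple, h, linearTuple_one]
  exact ⟨X_ne_zero', SameMap.refl _⟩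

theorem isBirational_linearTuple {A B : Matrix (Fin (m + 1)) (Fin (m + 1)) k} (h : A * B = 1)
    (h' : B * A = 1) : IsBirational (linearTuple A) :=
  ⟨isRational_linearTuple h, linearTuple B, isRational_linearTuple h',
    isLeftInverse_linearTuple h, isLeftInverse_linearTuple h'⟩

/-- The homomorphism `SL_{m+1}(k) → Bir(ℙ^m_k)` which maps a matrix to the automorphism of `ℙ^m_k`
that it induces. -/
def ofSL : Matrix.SpecialLinearGroup (Fin (m + 1)) k →* Bir k m where
  toFun A := Bir.mk (linearTuple A.1) (isBirational_linearTuple (B := (A⁻¹).1)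
    (congrArg Subtype.val (mul_inv_cancel A)) (congrArg Subtype.val (inv_mul_cancel A)))
  map_one' := (Bir.mk_eq_mk _ _).2 (by
    rw [Matrix.SpecialLinearGroup.coe_one, linearTuple_one]
    exact SameMap.refl _)
  map_mul' A B := (Bir.mk_eq_mk _ ((isBirational_linearTuple (B := (A⁻¹).1)
    (congrArg Subtype.val (mul_inv_cancel A)) (congrArg Subtype.val (inv_mul_cancel A))).comp
      (isBirational_linearTuple (B := (B⁻¹).1)
    (congrArg Subtype.val (mul_inv_cancel B)) (congrArg Subtype.val (inv_mul_cancel B))))).2 (by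
    rw [comp_linearTuple, Matrix.SpecialLinearGroup.coe_mul]
    exact SameMap.refl _)

/-- A matrix is virtually unipotent if one of its positive powers is unipotent. -/
def IsVirtuallyUnipotent (A : Matrix (Fin (m + 1)) (Fin (m + 1)) k) : Prop :=
  ∃ n : ℕ, 0 < n ∧ IsNilpotent (A ^ n - 1)

end Cremona

end

/-! Upper bounds. Over a normed field, measure a form by the sum of the norms of its coefficients.
Substituting a fixed birational tuple in a form of degree `q` changes this norm, in both directions,
by at most `R ^ p(q)` with `p` polynomial (`exists_normControl`); the lower estimate comes from
substituting an inverse tuple and dividing by the common factor that appears. Degrees along a word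
of length `n` are at most `d ^ n`, so the whole word distorts norms by at most `R ^ D ^ (n + 1)`
(`controlled_of_mem_pow`, `exists_sumNorm_bounds`). If the word equals `A ^ i`, compare the two on
linear forms. Two eigenforms whose eigenvalues have different norms give `ρ ^ i ≤ R ^ D ^ (n + 1)`
with `ρ > 1`, so `i` is at most exponential in `n`; a Jordan block of size two with eigenvalue `1`
gives only `i ≤ R ^ D ^ (n + 1)`, which is doubly exponential.

To obtain such a norm, descend to a countable field over which everything is defined. If `A` is not
virtually unipotent, some ratio of eigenvalues is not a root of unity, and a Kronecker-type argument
gives an embedding in `ℂ` or in the algebraic closure of some `ℚ_p` where this ratio has norm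
different from `1` (`exists_ringHom_norm_ne_one`). In the virtually unipotent case any embedding in
`ℂ` works.

Lower bounds. The monomial map `(x, y) ↦ (x y, x)` normalizes a two-dimensional torus and acts on it
by the Fibonacci matrix, whose square has trace `3` and determinant `1`; hence the power of a torus
element with exponent `traceSeq n` has length linear in `n`. A unipotent `U` is conjugate to `U ^
2`, so its powers are also exponentially short. By the Jordan decomposition every linear map is then
at least exponentially distorted (`hasLinearLength_ofGL`). Applied to the matrix `E` with `E * U *
E⁻¹ = U ^ 2`, this shortens `E ^ N` itself in `U ^ 2 ^ N = E ^ N * U * E ^ (-N)`, which gives the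
second exponential. -/

namespace Cremona

open MvPolynomial

/-! ### Coefficient norms of polynomials, and the cost of division -/

section SumNorm

variable {σ L : Type*} [NormedField L]

/-- The sum of the norms of the coefficients of a polynomial. -/
noncomputable def sumNorm (P : MvPolynomial σ L) : ℝ := ∑ s ∈ P.support, ‖P.coeff s‖

theorem sumNorm_eq_of_subset {P : MvPolynomial σ L} {T : Finset (σ →₀ ℕ)} (h : P.support ⊆ T) :
    sumNorm P = ∑ s ∈ T, ‖P.coeff s‖ :=
  Finset.sum_subset h fun s _ hs => by rw [notMem_support_iff.1 hs, norm_zero]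

theorem sumNorm_nonneg (P : MvPolynomial σ L) : 0 ≤ sumNorm P :=
  Finset.sum_nonneg fun _ _ => norm_nonneg _

@[simp]
theorem sumNorm_zero : sumNorm (0 : MvPolynomial σ L) = 0 := by simp [sumNorm]

theorem norm_coeff_le_sumNorm (P : MvPolynomial σ L) (s : σ →₀ ℕ) : ‖P.coeff s‖ ≤ sumNorm P := by
  classical
  rw [sumNorm_eq_of_subset (Finset.subset_insert s P.support)]
  exact Finset.single_le_sum (f := fun s => ‖P.coeff s‖) (fun _ _ => norm_nonneg _)
    (Finset.mem_insert_self _ _)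

theorem sumNorm_pos {P : MvPolynomial σ L} (hP : P ≠ 0) : 0 < sumNorm P := by
  obtain ⟨s, hs⟩ := ne_zero_iff.1 hP
  exact (norm_pos_iff.2 hs).trans_le (norm_coeff_le_sumNorm P s)

theorem sumNorm_add_le (P Q : MvPolynomial σ L) : sumNorm (P + Q) ≤ sumNorm P + sumNorm Q := by
  classical
  rw [sumNorm_eq_of_subset (support_add (p := P) (q := Q)),
    sumNorm_eq_of_subset (Finset.subset_union_left (s₁ := P.support) (s₂ := Q.support)),
    sumNorm_eq_of_subset (Finset.subset_union_right (s₁ := P.support) (s₂ := Q.support)),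
    ← Finset.sum_add_distrib]
  exact Finset.sum_le_sum fun s _ => by rw [coeff_add]; exact norm_add_le _ _

theorem sumNorm_neg (P : MvPolynomial σ L) : sumNorm (-P) = sumNorm P := by
  simp [sumNorm, support_neg]

theorem sumNorm_sub_le (P Q : MvPolynomial σ L) : sumNorm (P - Q) ≤ sumNorm P + sumNorm Q := by
  rw [sub_eq_add_neg, ← sumNorm_neg Q]
  exact sumNorm_add_le _ _

theorem sumNorm_sum_le {ι : Type*} (T : Finset ι) (f : ι → MvPolynomial σ L) :
    sumNorm (∑ i ∈ T, f i) ≤ ∑ i ∈ T, sumNorm (f i) :=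
  Finset.le_sum_of_subadditive _ sumNorm_zero.le sumNorm_add_le _ _

theorem sumNorm_monomial (s : σ →₀ ℕ) (a : L) : sumNorm (monomial s a) = ‖a‖ := by
  classical
  rw [sumNorm_eq_of_subset (support_monomial_subset (s := s) (a := a))]
  simp

theorem sumNorm_X (i : σ) : sumNorm (X i : MvPolynomial σ L) = 1 := by
  rw [X, sumNorm_monomial, norm_one]

theorem sumNorm_one : sumNorm (1 : MvPolynomial σ L) = 1 := by
  rw [← C_1, C_apply, sumNorm_monomial, norm_one]

theorem sumNorm_C_mul (a : L) (P : MvPolynomial σ L) : sumNorm (C a * P) = ‖a‖ * sumNorm P := by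
  have h : (C a * P).support ⊆ P.support := fun s hs => by
    rw [mem_support_iff, coeff_C_mul] at hs
    exact mem_support_iff.2 (right_ne_zero_of_mul hs)
  rw [sumNorm_eq_of_subset h, sumNorm, Finset.mul_sum]
  simp

theorem sumNorm_mul_le (P Q : MvPolynomial σ L) : sumNorm (P * Q) ≤ sumNorm P * sumNorm Q := by
  have h : P * Q = ∑ s ∈ P.support, ∑ t ∈ Q.support,
      monomial (s + t) (P.coeff s * Q.coeff t) := by
    conv_lhs => rw [P.as_sum, Q.as_sum]
    simp only [Finset.sum_mul_sum, monomial_mul]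
  rw [h, show sumNorm P * sumNorm Q = _ from Finset.sum_mul_sum _ _ _ _]
  refine (sumNorm_sum_le _ _).trans (Finset.sum_le_sum fun s _ => (sumNorm_sum_le _ _).trans
    (Finset.sum_le_sum fun t _ => ?_))
  rw [sumNorm_monomial, norm_mul]

theorem sumNorm_pow_le (P : MvPolynomial σ L) (n : ℕ) : sumNorm (P ^ n) ≤ sumNorm P ^ n := by
  induction n with
  | zero => simp [sumNorm_one]
  | succ n ih =>
    rw [pow_succ, pow_succ]
    exact (sumNorm_mul_le _ _).trans (mul_le_mul_of_nonneg_right ih (sumNorm_nonneg _))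

/-- If multiplication by `P` raises the leading coefficient to a scalar `a`, then division by `P`
increases the norm of a polynomial by a factor controlled by the number of its monomials. -/
theorem sumNorm_le_pow_mul [LinearOrder σ] [WellFoundedGT σ] (P : MvPolynomial σ L) {K : ℝ}
    (hK : 1 + (sumNorm P + 1) / ‖MonomialOrder.lex.leadingCoeff P‖ ≤ K) (hP : P ≠ 0) :
    ∀ (N : ℕ) (Q : MvPolynomial σ L), Q.support.card ≤ N →
      sumNorm Q ≤ K ^ N * sumNorm (P * Q) := by
  have hlc : 0 < ‖MonomialOrder.lex.leadingCoeff P‖ :=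
    norm_pos_iff.2 (MonomialOrder.lex.leadingCoeff_ne_zero_iff.2 hP)
  set p := ‖MonomialOrder.lex.leadingCoeff P‖ with hp
  have hK1 : 1 ≤ K := le_trans (le_add_of_nonneg_right
    (div_nonneg (add_nonneg (sumNorm_nonneg P) zero_le_one) hlc.le)) hK
  intro N
  induction N with
  | zero =>
    intro Q hQ
    have : Q = 0 := by simpa using hQ
    simp [this]
  | succ N ih =>
    intro Q hQ
    by_cases hQ0 : Q = 0
    · simp [hQ0]
    set β := MonomialOrder.lex.degree Q with hβ
    set b := MonomialOrder.lex.leadingCoeff Q with hb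
    -- Leading coefficients multiply, so the leading term of `Q` is controlled by `P * Q`. Removing
    -- it leaves fewer monomials, and the induction applies.
    have hbP : ‖b‖ * p ≤ sumNorm (P * Q) := by
      rw [mul_comm, hp, ← norm_mul, ← MonomialOrder.leadingCoeff_mul]
      exact norm_coeff_le_sumNorm _ _
    have hb' : ‖b‖ ≤ sumNorm (P * Q) / p := by rwa [le_div_iff₀ hlc]
    set Q' := Q - monomial β b with hQ'
    have hcard : Q'.support.card ≤ N := by
      have hsub : Q'.support ⊆ Q.support.erase β := by
        classical
        intro s hs
        rw [mem_support_iff, hQ', coeff_sub, coeff_monomial] at hs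
        rw [Finset.mem_erase, mem_support_iff]
        by_cases h : β = s
        · rw [if_pos h, ← h] at hs
          exact absurd (sub_self _) hs
        · rw [if_neg h, sub_zero] at hs
          exact ⟨fun h' => h h'.symm, hs⟩
      have hmem : β ∈ Q.support :=
        mem_support_iff.2 (MonomialOrder.lex.leadingCoeff_ne_zero_iff.2 hQ0)
      have := Finset.card_le_card hsub
      rw [Finset.card_erase_of_mem hmem] at this
      omega
    have h1 : sumNorm (P * Q') ≤ sumNorm (P * Q) * (1 + sumNorm P / p) := by
      rw [hQ', mul_sub]
      refine (sumNorm_sub_le _ _).trans ?_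
      have : sumNorm (P * monomial β b) ≤ sumNorm P * (sumNorm (P * Q) / p) :=
        (sumNorm_mul_le _ _).trans
          (mul_le_mul_of_nonneg_left (by rwa [sumNorm_monomial]) (sumNorm_nonneg _))
      calc _ ≤ sumNorm (P * Q) + sumNorm P * (sumNorm (P * Q) / p) := by gcongr
        _ = _ := by ring
    have h2 : sumNorm Q ≤ sumNorm Q' + ‖b‖ := by
      have := sumNorm_add_le Q' (monomial β b)
      rwa [sumNorm_monomial, hQ', sub_add_cancel] at this
    have hN : 1 ≤ K ^ N := one_le_pow₀ hK1
    have hPQ := sumNorm_nonneg (P * Q)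
    calc sumNorm Q ≤ K ^ N * (sumNorm (P * Q) * (1 + sumNorm P / p)) + sumNorm (P * Q) / p := by
          refine h2.trans (add_le_add ((ih Q' hcard).trans ?_) hb')
          gcongr
      _ ≤ K ^ N * (sumNorm (P * Q) * (1 + sumNorm P / p)) + K ^ N * (sumNorm (P * Q) / p) := by
          gcongr
          exact le_mul_of_one_le_left (div_nonneg hPQ hlc.le) hN
      _ = K ^ N * sumNorm (P * Q) * (1 + (sumNorm P + 1) / p) := by ring
      _ ≤ K ^ N * sumNorm (P * Q) * K := by gcongr
      _ = K ^ (N + 1) * sumNorm (P * Q) := by ring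

/-- Dividing once by `P ^ q`, rather than `q` times by `P`, keeps the number of monomials of the
intermediate quotients out of the estimate. The leading coefficient and the norm bound of `P ^ q`
are `q`-th powers, so one `K` serves all `q`. -/
theorem exists_sumNorm_le_pow_mul_pow_mul [LinearOrder σ] [WellFoundedGT σ]
    {P : MvPolynomial σ L} (hP : P ≠ 0) :
    ∃ K : ℝ, 1 ≤ K ∧ ∀ (q : ℕ) (Q : MvPolynomial σ L),
      sumNorm Q ≤ K ^ ((q + 1) * Q.support.card) * sumNorm (P ^ q * Q) := by
  set p := ‖MonomialOrder.lex.leadingCoeff P‖ with hp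
  have hlc : 0 < p := norm_pos_iff.2 (MonomialOrder.lex.leadingCoeff_ne_zero_iff.2 hP)
  have hx : 0 ≤ (sumNorm P + 1) / p :=
    div_nonneg (add_nonneg (sumNorm_nonneg P) zero_le_one) hlc.le
  refine ⟨2 + (sumNorm P + 1) / p, by linarith, fun q Q => ?_⟩
  rw [pow_mul]
  refine sumNorm_le_pow_mul (P ^ q) ?_ (pow_ne_zero _ hP) _ Q le_rfl
  rw [MonomialOrder.leadingCoeff_pow, norm_pow, ← hp]
  have h1 : (sumNorm (P ^ q) + 1) / p ^ q ≤ 2 * ((sumNorm P + 1) / p) ^ q := by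
    have h2 : 1 ≤ (sumNorm P + 1) ^ q := one_le_pow₀ (by linarith [sumNorm_nonneg P])
    have h3 : sumNorm (P ^ q) ≤ (sumNorm P + 1) ^ q := (sumNorm_pow_le P q).trans
      (pow_le_pow_left₀ (sumNorm_nonneg P) (by linarith) q)
    rw [div_pow, ← mul_div_assoc]
    exact div_le_div_of_nonneg_right (by linarith) (pow_nonneg hlc.le q)
  set x := (sumNorm P + 1) / p with hxdef
  have hx1 : 1 ≤ x := by
    rw [hxdef, le_div_iff₀ hlc, one_mul]
    have : p ≤ sumNorm P := norm_coeff_le_sumNorm _ _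
    linarith
  have h6 : 1 ≤ (2 + x) ^ q := one_le_pow₀ (by linarith)
  have h7 : x ^ q ≤ (2 + x) ^ q := pow_le_pow_left₀ hx (by linarith) q
  rw [pow_succ]
  nlinarith

theorem sumNorm_bind₁_le {τ : Type*} {Q : MvPolynomial σ L} {q : ℕ} (hQ : Q.IsHomogeneous q)
    (F : σ → MvPolynomial τ L) {R : ℝ} (hF : ∀ i, sumNorm (F i) ≤ R) :
    sumNorm (bind₁ F Q) ≤ R ^ q * sumNorm Q := by
  have h : bind₁ F Q = ∑ s ∈ Q.support, C (Q.coeff s) * ∏ i ∈ s.support, F i ^ s i := by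
    rw [bind₁, aeval_def, eval₂_eq]
    rfl
  rw [h, show R ^ q * sumNorm Q = _ from Finset.mul_sum _ _ _]
  refine (sumNorm_sum_le _ _).trans (Finset.sum_le_sum fun s hs => ?_)
  rw [sumNorm_C_mul, mul_comm]
  refine mul_le_mul_of_nonneg_right ?_ (norm_nonneg _)
  have h1 : ∀ T : Finset σ, sumNorm (∏ i ∈ T, F i ^ s i) ≤ ∏ i ∈ T, R ^ s i := by
    classical
    intro T
    induction T using Finset.induction_on with
    | empty => simp [sumNorm_one]
    | insert i T hi ih =>
      rw [Finset.prod_insert hi, Finset.prod_insert hi]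
      refine (sumNorm_mul_le _ _).trans (mul_le_mul ?_ ih (sumNorm_nonneg _)
        (pow_nonneg ((sumNorm_nonneg _).trans (hF i)) _))
      exact (sumNorm_pow_le _ _).trans (pow_le_pow_left₀ (sumNorm_nonneg _) (hF i) _)
  refine (h1 _).trans ?_
  rw [Finset.prod_pow_eq_pow_sum, ← hQ.degree_eq_sum_deg_support hs]

theorem card_support_le [Fintype σ] {Q : MvPolynomial σ L} {q : ℕ} (hQ : Q.IsHomogeneous q) :
    Q.support.card ≤ (q + 1) ^ Fintype.card σ := by
  classical
  have h : ∀ s ∈ Q.support, ∀ i, s i < q + 1 := fun s hs i => by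
    have h1 := hQ.degree_eq_sum_deg_support hs
    by_cases hi : i ∈ s.support
    · have := Finset.single_le_sum (f := s) (fun _ _ => Nat.zero_le _) hi
      omega
    · rw [Finsupp.notMem_support_iff.1 hi]
      exact Nat.succ_pos q
  have h2 : Q.support.card ≤ (Fintype.piFinset fun _ : σ => Finset.range (q + 1)).card :=
    Finset.card_le_card_of_injOn (fun s => ⇑s)
      (fun s hs => by simpa using fun i => Nat.lt_succ_iff.1 (h s hs i))
      (fun s _ t _ hst => DFunLike.coe_injective hst)
  simpa using h2

end SumNorm

end Cremona

namespace Cremona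

open MvPolynomial

/-! ### Degrees and norms along words in birational maps -/

section Growth

variable {L : Type*} [NormedField L] {m : ℕ}

/-- Substituting `F` in a homogeneous polynomial of degree `q` changes its norm by a factor at most
`R ^ φ q` in both directions. -/
def NormControl (F : Tuple L m) (R : ℝ) (φ : ℕ → ℕ) : Prop :=
  ∀ (q : ℕ) (Q : MvPolynomial (Fin (m + 1)) L), Q.IsHomogeneous q →
    sumNorm (bind₁ F Q) ≤ R ^ φ q * sumNorm Q ∧ sumNorm Q ≤ R ^ φ q * sumNorm (bind₁ F Q)

theorem NormControl.mono {F : Tuple L m} {R R' : ℝ} {φ φ' : ℕ → ℕ} (h : NormControl F R φ)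
    (hR : 1 ≤ R) (hRR' : R ≤ R') (hφ : ∀ q, φ q ≤ φ' q) : NormControl F R' φ' := by
  intro q Q hQ
  have h1 : R ^ φ q ≤ R' ^ φ' q := (pow_le_pow_right₀ hR (hφ q)).trans
    (pow_le_pow_left₀ (by linarith) hRR' _)
  exact ⟨(h q Q hQ).1.trans (mul_le_mul_of_nonneg_right h1 (sumNorm_nonneg _)),
    (h q Q hQ).2.trans (mul_le_mul_of_nonneg_right h1 (sumNorm_nonneg _))⟩

/-- The upper estimate is direct. For the lower one, `F ∘ G` is projectively the identity, so
substituting `G` in `bind₁ F Q` and multiplying by `X j ^ q` gives `(comp F G j) ^ q * Q`, which is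
then divided by the fixed polynomial `comp F G j`. The exponent is `q + 1` times the number of
monomials, at most `(q + 1) ^ (m + 1)`. -/
theorem exists_normControl {F G : Tuple L m} (hF : IsRational F) (h : IsLeftInverse F G) :
    ∃ R : ℝ, 1 ≤ R ∧ NormControl F R fun q => (q + 1) ^ (m + 2) := by
  obtain ⟨e, he⟩ := hF.2
  obtain ⟨j, hj'⟩ := Function.ne_iff.1 h.1
  have hj : comp F G j ≠ 0 := hj'
  obtain ⟨K, hK1, hK⟩ := exists_sumNorm_le_pow_mul_pow_mul hj
  have hbound : ∀ F : Tuple L m, ∃ R : ℝ, 1 ≤ R ∧ ∀ i, sumNorm (F i) ≤ R := fun F =>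
    ⟨1 + ∑ i, sumNorm (F i),
      le_add_of_nonneg_right (Finset.sum_nonneg fun i _ => sumNorm_nonneg (F i)), fun i => by
      linarith [Finset.single_le_sum (f := fun i => sumNorm (F i)) (fun i _ => sumNorm_nonneg (F i))
        (Finset.mem_univ i)]⟩
  obtain ⟨RF, hRF1, hRF⟩ := hbound F
  obtain ⟨RG, hRG1, hRG⟩ := hbound G
  have hRGe : 1 ≤ RG ^ e := one_le_pow₀ hRG1
  have hR : 1 ≤ K * RG ^ e := one_le_mul_of_one_le_of_one_le hK1 hRGe
  refine ⟨max RF (K * RG ^ e), hRF1.trans (le_max_left _ _), fun q Q hQ => ?_⟩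
  have hq : q ≤ (q + 1) ^ (m + 2) :=
    (Nat.le_succ q).trans (Nat.le_self_pow (by omega) _)
  refine ⟨(sumNorm_bind₁_le hQ F hRF).trans (mul_le_mul_of_nonneg_right ?_ (sumNorm_nonneg _)), ?_⟩
  · exact (pow_le_pow_right₀ hRF1 hq).trans (pow_le_pow_left₀ (by linarith) (le_max_left _ _) _)
  · have h1 := h.2.bind₁_eq hQ j
    rw [bind₁_X_left, AlgHom.id_apply] at h1
    have h2 : sumNorm (comp F G j ^ q * Q) ≤ (RG ^ e) ^ q * sumNorm (bind₁ F Q) := by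
      rw [← h1]
      refine (sumNorm_mul_le _ _).trans ?_
      have h3 : bind₁ (comp F G) Q = bind₁ G (bind₁ F Q) := (bind₁_bind₁ _ _ _).symm
      rw [h3, ← pow_mul]
      refine (mul_le_mul ((sumNorm_pow_le _ _).trans ?_)
        (sumNorm_bind₁_le (hQ.aeval _ he) G hRG) (sumNorm_nonneg _) zero_le_one).trans_eq
        (one_mul _)
      rw [sumNorm_X, one_pow]
    have h4 : (q + 1) * Q.support.card ≤ (q + 1) ^ (m + 2) := by
      have := card_support_le hQ
      rw [Fintype.card_fin] at this
      rw [pow_succ' _ (m + 1)]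
      exact Nat.mul_le_mul_left _ this
    calc sumNorm Q ≤ K ^ ((q + 1) * Q.support.card) * sumNorm (comp F G j ^ q * Q) := hK q Q
      _ ≤ K ^ (q + 1) ^ (m + 2) * ((RG ^ e) ^ q * sumNorm (bind₁ F Q)) := by
        gcongr
        exact sumNorm_nonneg _
      _ ≤ K ^ (q + 1) ^ (m + 2) * ((RG ^ e) ^ (q + 1) ^ (m + 2) * sumNorm (bind₁ F Q)) := by
        gcongr
        exact sumNorm_nonneg _
      _ = (K * RG ^ e) ^ (q + 1) ^ (m + 2) * sumNorm (bind₁ F Q) := by rw [mul_pow]; ring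
      _ ≤ _ := mul_le_mul_of_nonneg_right
        (pow_le_pow_left₀ (by linarith) (le_max_right _ _) _) (sumNorm_nonneg _)

/-- `g` is represented by forms of degree at most `d` with the given control on norms. -/
def Bir.Controlled (g : Bir L m) (d : ℕ) (R : ℝ) (φ : ℕ → ℕ) : Prop :=
  ∃ (F : Tuple L m) (hF : IsBirational F), g = Bir.mk F hF ∧
    (∃ e ≤ d, ∀ i, (F i).IsHomogeneous e) ∧ NormControl F R φ

theorem Bir.exists_controlled (g : Bir L m) :
    ∃ d : ℕ, 1 ≤ d ∧ ∃ R : ℝ, 1 ≤ R ∧ g.Controlled d R fun q => (q + 1) ^ (m + 2) := by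
  obtain ⟨⟨F, hF⟩, rfl⟩ := Quotient.exists_rep g
  obtain ⟨hFr, G, -, h, -⟩ := id hF
  obtain ⟨e, he⟩ := hFr.2
  obtain ⟨R, hR, hc⟩ := exists_normControl hFr h
  exact ⟨e + 1, by omega, R, hR, F, hF, rfl, ⟨e, by omega, he⟩, hc⟩

theorem exists_controlled_of_finite {S : Set (Bir L m)} (hS : S.Finite) :
    ∃ d : ℕ, 1 ≤ d ∧ ∃ R : ℝ, 1 ≤ R ∧ ∀ g ∈ S, g.Controlled d R fun q => (q + 1) ^ (m + 2) := by
  induction S, hS using Set.Finite.induction_on with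
  | empty => exact ⟨1, le_rfl, 1, le_rfl, by simp⟩
  | @insert g S _ _ ih =>
    obtain ⟨d, hd, R, hR, h⟩ := ih
    obtain ⟨d', hd', R', hR', h'⟩ := g.exists_controlled
    refine ⟨max d d', hd.trans (le_max_left _ _), max R R', hR.trans (le_max_left _ _), ?_⟩
    rintro f (rfl | hf)
    · obtain ⟨F, hF, hf, ⟨e, he, hom⟩, hc⟩ := h'
      exact ⟨F, hF, hf, ⟨e, he.trans (le_max_right _ _), hom⟩,
        hc.mono hR' (le_max_right _ _) fun _ => le_rfl⟩
    · obtain ⟨F, hF, hf, ⟨e, he, hom⟩, hc⟩ := h f hf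
      exact ⟨F, hF, hf, ⟨e, he.trans (le_max_left _ _), hom⟩,
        hc.mono hR (le_max_left _ _) fun _ => le_rfl⟩

/-- Each new letter is substituted in a form of degree at most `d ^ n * q`, and the exponents of `R`
add up. The total exponent is therefore polynomial in `d ^ n`, that is, simply exponential in `n`.
-/
theorem controlled_of_mem_pow {S : Set (Bir L m)} {d : ℕ} (hd : 1 ≤ d) {R : ℝ} (hR : 1 ≤ R)
    {a : ℕ} (hS : ∀ g ∈ S, g.Controlled d R fun q => (q + 1) ^ a) (n : ℕ) :
    ∀ g ∈ S ^ n, g.Controlled (d ^ n) R fun q => n * (d ^ n * q + 1) ^ a := by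
  induction n with
  | zero =>
    intro g hg
    rw [pow_zero, Set.mem_one] at hg
    refine ⟨X, isBirational_X, hg.trans Bir.one_def,
      ⟨1, by simp, fun i => isHomogeneous_X L i⟩, fun q Q _ => ?_⟩
    simp
  | succ n ih =>
    intro g hg
    rw [pow_succ] at hg
    obtain ⟨g', hg', s, hs, rfl⟩ := Set.mem_mul.1 hg
    obtain ⟨W, hW, rfl, ⟨e, he, hom⟩, hc⟩ := ih g' hg'
    obtain ⟨F, hF, rfl, ⟨e', he', hom'⟩, hc'⟩ := hS s hs
    refine ⟨comp W F, hW.comp hF, Bir.mk_mul_mk hW hF,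
      ⟨e' * e, ?_, fun i => (hom i).aeval _ hom'⟩, ?_⟩
    · rw [pow_succ']
      exact Nat.mul_le_mul he' he
    · intro q Q hQ
      have h1 : bind₁ (comp W F) Q = bind₁ F (bind₁ W Q) := (bind₁_bind₁ _ _ _).symm
      have h2 := hc q Q hQ
      have h3 := hc' (e * q) (bind₁ W Q) (hQ.aeval _ hom)
      have hexp : (e * q + 1) ^ a + n * (d ^ n * q + 1) ^ a
          ≤ (n + 1) * (d ^ (n + 1) * q + 1) ^ a := by
        have h4 : (e * q + 1) ^ a ≤ (d ^ (n + 1) * q + 1) ^ a := by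
          gcongr
          exact he.trans (Nat.pow_le_pow_right hd n.le_succ)
        have h5 : (d ^ n * q + 1) ^ a ≤ (d ^ (n + 1) * q + 1) ^ a := by
          gcongr
          exact n.le_succ
        calc _ ≤ (d ^ (n + 1) * q + 1) ^ a + n * (d ^ (n + 1) * q + 1) ^ a :=
              Nat.add_le_add h4 (Nat.mul_le_mul_left _ h5)
          _ = _ := by ring
      have hpow := pow_le_pow_right₀ hR hexp
      rw [pow_add] at hpow
      have hR0 : ∀ k : ℕ, 0 ≤ R ^ k := fun k => pow_nonneg (by linarith) k
      rw [h1]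
      constructor
      · refine (h3.1.trans (mul_le_mul_of_nonneg_left h2.1 (hR0 _))).trans ?_
        rw [← mul_assoc]
        exact mul_le_mul_of_nonneg_right hpow (sumNorm_nonneg _)
      · refine (h2.2.trans (mul_le_mul_of_nonneg_left h3.2 (hR0 _))).trans ?_
        rw [← mul_assoc, mul_comm (R ^ _) (R ^ _)]
        exact mul_le_mul_of_nonneg_right hpow (sumNorm_nonneg _)

end Growth

/-! ### Linear forms under substitution -/

section LinearForm

variable {R : Type*} [Field R] {m : ℕ}

/-- The linear form with coefficients `v`. -/
noncomputable def linearForm (v : Fin (m + 1) → R) : MvPolynomial (Fin (m + 1)) R :=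
  ∑ j, C (v j) * X j

theorem linearForm_isHomogeneous (v : Fin (m + 1) → R) : (linearForm v).IsHomogeneous 1 :=
  IsHomogeneous.sum _ _ _ fun _ _ => isHomogeneous_C_mul_X _ _

theorem linearForm_injective : Function.Injective (linearForm : (Fin (m + 1) → R) → _) := by
  intro v w h
  funext i
  have := congrArg (eval (Pi.single i 1)) h
  simpa [linearForm, Pi.single_apply] using this

theorem linearForm_zero : linearForm (0 : Fin (m + 1) → R) = 0 := by simp [linearForm]

theorem linearForm_ne_zero {v : Fin (m + 1) → R} (hv : v ≠ 0) : linearForm v ≠ 0 := fun h =>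
  hv (linearForm_injective (h.trans linearForm_zero.symm))

theorem linearForm_add (v w : Fin (m + 1) → R) :
    linearForm (v + w) = linearForm v + linearForm w := by
  simp [linearForm, add_mul, Finset.sum_add_distrib]

theorem linearForm_smul (a : R) (v : Fin (m + 1) → R) :
    linearForm (a • v) = C a * linearForm v := by
  simp [linearForm, Finset.mul_sum, mul_assoc]

-- Substitution acts on row vectors, so the eigenvectors used below are left eigenvectors.
open Matrix in
theorem bind₁_linearTuple (A : Matrix (Fin (m + 1)) (Fin (m + 1)) R) (v : Fin (m + 1) → R) :
    bind₁ (linearTuple A) (linearForm v) = linearForm (v ᵥ* A) := by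
  simp only [linearForm, linearTuple, map_sum, map_mul, bind₁_X_right, algHom_C, algebraMap_eq,
    Matrix.vecMul, dotProduct, Finset.mul_sum, Finset.sum_mul]
  rw [Finset.sum_comm]
  simp only [mul_assoc]

/-- The cross-multiplied form avoids the unknown common factor between two representatives of the
same map. The upper bounds use equality in the Cremona group only through this identity. -/
theorem SameMap.bind₁_linearForm {F G : Tuple R m} (h : SameMap F G) (v w : Fin (m + 1) → R) :
    bind₁ F (linearForm v) * bind₁ G (linearForm w)
      = bind₁ F (linearForm w) * bind₁ G (linearForm v) := by
  simp only [linearForm, map_sum, map_mul, bind₁_X_right, algHom_C, Finset.sum_mul_sum]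
  rw [Finset.sum_comm]
  refine Finset.sum_congr rfl fun i _ => Finset.sum_congr rfl fun j _ => ?_
  linear_combination (algebraMap R _ (v j) * algebraMap R _ (w i)) * h j i

end LinearForm

end Cremona

namespace Cremona

open MvPolynomial Matrix

/-! ### Bounds on `i` when `A ^ i` is a short word, over a normed field -/

section Bounds

variable {L : Type*} [NormedField L] {m : ℕ}

theorem mul_succ_pow_le (d n a : ℕ) (hd : 1 ≤ d) :
    (n + 1) * (d ^ n + 1) ^ a ≤ (2 ^ (a + 1) * d ^ a) ^ (n + 1) := by
  have h1 : n + 1 ≤ 2 ^ n := Nat.lt_two_pow_self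
  have h2 : d ^ n + 1 ≤ 2 * d ^ n := by have := Nat.one_le_pow n d hd; omega
  have hda : 1 ≤ d ^ a := Nat.one_le_pow _ _ hd
  calc (n + 1) * (d ^ n + 1) ^ a ≤ 2 ^ n * (2 * d ^ n) ^ a :=
        Nat.mul_le_mul h1 (Nat.pow_le_pow_left h2 a)
    _ = 2 ^ a * (2 * d ^ a) ^ n := by rw [mul_pow, mul_pow, ← pow_mul, ← pow_mul, mul_comm n a]; ring
    _ ≤ (2 ^ (a + 1) * d ^ a) * (2 ^ (a + 1) * d ^ a) ^ n := by
        refine Nat.mul_le_mul ?_ (Nat.pow_le_pow_left (Nat.mul_le_mul_right _ ?_) n)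
        · rw [pow_succ, mul_assoc]
          exact Nat.le_mul_of_pos_right _ (by omega)
        · rw [pow_succ]
          exact Nat.le_mul_of_pos_left _ (by positivity)
    _ = _ := (pow_succ' _ _).symm

/-- Two-sided bounds for products of linear forms, one of which is transformed by a word of
length `n`. -/
theorem exists_sumNorm_bounds {d : ℕ} (hd : 1 ≤ d) {R : ℝ} (hR : 1 ≤ R)
    {v w : Fin (m + 1) → L} (hv : v ≠ 0) (hw : w ≠ 0) :
    ∃ R' : ℝ, 1 ≤ R' ∧ ∀ (n : ℕ) (W : Tuple L m), (∃ e ≤ d ^ n, ∀ i, (W i).IsHomogeneous e) →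
      NormControl W R (fun q => n * (d ^ n * q + 1) ^ (m + 2)) →
      sumNorm (bind₁ W (linearForm v) * linearForm w)
        ≤ R' ^ (2 ^ (m + 4) * d ^ (m + 2)) ^ (n + 1) ∧
      1 ≤ R' ^ (2 ^ (m + 4) * d ^ (m + 2)) ^ (n + 1)
        * sumNorm (bind₁ W (linearForm v) * linearForm w) := by
  obtain ⟨K, hK1, hK⟩ := exists_sumNorm_le_pow_mul_pow_mul (linearForm_ne_zero hw)
  have hNv := sumNorm_pos (linearForm_ne_zero hv)
  have hNw := sumNorm_pos (linearForm_ne_zero hw)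
  set Nv := sumNorm (linearForm v)
  set Nw := sumNorm (linearForm w)
  -- One constant that is at least `1` and absorbs both the upper factor `Nv * Nw` and the lower
  -- factor `Nv⁻¹`.
  set T := 1 + Nv * Nw + Nv⁻¹ with hT
  have hT0 : 0 < Nv * Nw := mul_pos hNv hNw
  have hT1 : 0 < Nv⁻¹ := inv_pos.2 hNv
  have hT2 : 1 ≤ T := by linarith
  have hKT : 1 ≤ K * T := one_le_mul_of_one_le_of_one_le hK1 hT2
  refine ⟨R * K * T, ?_, ?_⟩
  · rw [mul_assoc]
    exact one_le_mul_of_one_le_of_one_le hR hKT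
  rintro n W ⟨e, he, hom⟩ hc
  set D := (2 ^ (m + 4) * d ^ (m + 2)) ^ (n + 1) with hD
  -- The factor `2` pays for the exponent `(1 + 1) * Q.support.card` in the division by the linear
  -- form of `w`.
  have hmain : 2 * ((n + 1) * (d ^ n + 1) ^ (m + 2)) ≤ D := by
    have h := mul_succ_pow_le d n (m + 2) hd
    calc _ ≤ 2 * (2 ^ (m + 2 + 1) * d ^ (m + 2)) ^ (n + 1) := Nat.mul_le_mul_left _ h
      _ ≤ 2 ^ (n + 1) * (2 ^ (m + 2 + 1) * d ^ (m + 2)) ^ (n + 1) :=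
        Nat.mul_le_mul_right _ (Nat.le_self_pow (by omega) _)
      _ = D := by rw [hD, ← mul_pow]; ring_nf
  have hD1 : 1 ≤ D := le_trans (by
    have : 0 < (n + 1) * (d ^ n + 1) ^ (m + 2) := by positivity
    omega) hmain
  obtain ⟨h1, h2⟩ := hc 1 _ (linearForm_isHomogeneous v)
  set Q := bind₁ W (linearForm v) with hQ
  have hQhom : Q.IsHomogeneous e := by
    have := (linearForm_isHomogeneous v).aeval W hom
    rwa [mul_one] at this
  have hexp1 : n * (d ^ n * 1 + 1) ^ (m + 2) ≤ D := by
    rw [mul_one]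
    refine le_trans ?_ hmain
    nlinarith [Nat.zero_le ((d ^ n + 1) ^ (m + 2))]
  have hexp2 : (1 + 1) * Q.support.card ≤ D := by
    have hs := card_support_le hQhom
    rw [Fintype.card_fin] at hs
    have hs2 : (e + 1) ^ (m + 1) ≤ (d ^ n + 1) ^ (m + 2) :=
      (Nat.pow_le_pow_left (by omega) _).trans (Nat.pow_le_pow_right (by omega) (by omega))
    refine le_trans ?_ hmain
    nlinarith
  have hRp : R ^ (n * (d ^ n * 1 + 1) ^ (m + 2)) ≤ R ^ D := pow_le_pow_right₀ hR hexp1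
  have hKp : K ^ ((1 + 1) * Q.support.card) ≤ K ^ D := pow_le_pow_right₀ hK1 hexp2
  have hTp : T ≤ T ^ D := le_self_pow₀ hT2 (by omega)
  have hRD : 1 ≤ R ^ D := one_le_pow₀ hR
  have hKD : 1 ≤ K ^ D := one_le_pow₀ hK1
  rw [mul_pow, mul_pow]
  constructor
  · calc sumNorm (Q * linearForm w) ≤ sumNorm Q * Nw := sumNorm_mul_le _ _
      _ ≤ R ^ D * Nv * Nw := by
        gcongr
        exact h1.trans (mul_le_mul_of_nonneg_right hRp hNv.le)
      _ = R ^ D * 1 * (Nv * Nw) := by ring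
      _ ≤ R ^ D * K ^ D * T ^ D := by
        gcongr
        linarith
  · have h3 := hK 1 Q
    rw [pow_one, mul_comm (linearForm w)] at h3
    have h4 : Nv ≤ R ^ D * (K ^ D * sumNorm (Q * linearForm w)) := by
      refine h2.trans (mul_le_mul hRp (h3.trans ?_) (sumNorm_nonneg _) (by positivity))
      exact mul_le_mul_of_nonneg_right hKp (sumNorm_nonneg _)
    have hN := sumNorm_nonneg (Q * linearForm w)
    calc 1 = Nv⁻¹ * Nv := (inv_mul_cancel₀ hNv.ne').symm
      _ ≤ T ^ D * (R ^ D * (K ^ D * sumNorm (Q * linearForm w))) := by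
        gcongr
        linarith
      _ = _ := by ring

/-- `c ^ i` is represented by the matrix `A ^ i`. -/
theorem ofSL_pow_eq {k : Type*} [Field k] (A : Matrix.SpecialLinearGroup (Fin (m + 1)) k) (i : ℕ) :
    ∃ h, ofSL A ^ i = Bir.mk (linearTuple (A.1 ^ i)) h := by
  rw [← map_pow]
  have h : ((A ^ i : Matrix.SpecialLinearGroup (Fin (m + 1)) k)).1 = A.1 ^ i :=
    Matrix.SpecialLinearGroup.coe_pow A i
  rw [← h]
  exact ⟨_, rfl⟩

theorem vecMul_pow_of_eigen {k : Type*} [Field k] {A : Matrix (Fin (m + 1)) (Fin (m + 1)) k}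
    {v : Fin (m + 1) → k} {a : k} (h : v ᵥ* A = a • v) (i : ℕ) : v ᵥ* A ^ i = a ^ i • v := by
  induction i with
  | zero => simp
  | succ i ih => rw [pow_succ, ← vecMul_vecMul, ih, smul_vecMul, h, smul_smul, pow_succ]

theorem vecMul_pow_of_shift {k : Type*} [Field k] {A : Matrix (Fin (m + 1)) (Fin (m + 1)) k}
    {v w : Fin (m + 1) → k} (hv : v ᵥ* A = v) (hw : w ᵥ* A = w + v) (i : ℕ) :
    w ᵥ* A ^ i = w + (i : k) • v := by
  induction i with
  | zero => simp
  | succ i ih =>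
    rw [pow_succ, ← vecMul_vecMul, ih, add_vecMul, smul_vecMul, hv, hw]
    push_cast
    rw [add_smul, one_smul]
    abel

/-- If `W` represents `A ^ i`, cross-multiplication on the two eigenforms gives `b ^ i * (W*v · w) =
a ^ i * (W*w · v)`. Both products have norms bounded above and below, so `(‖a‖ / ‖b‖) ^ i` is at
most a constant to the power `D ^ (n + 1)`. The norm may be archimedean or not. -/
theorem exists_le_pow_of_eigenvectors (A : Matrix.SpecialLinearGroup (Fin (m + 1)) L)
    {S : Set (Bir L m)} (hS : S.Finite) {v w : Fin (m + 1) → L} (hv : v ≠ 0) (hw : w ≠ 0)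
    {a b : L} (hva : v ᵥ* A.1 = a • v) (hwb : w ᵥ* A.1 = b • w) (hb : b ≠ 0) (hab : ‖b‖ < ‖a‖) :
    ∃ B : ℕ, ∀ n i : ℕ, ofSL A ^ i ∈ S ^ n → i ≤ B ^ (n + 1) := by
  obtain ⟨d, hd, R, hR, hSc⟩ := exists_controlled_of_finite hS
  obtain ⟨R₁, hR₁, h₁⟩ := exists_sumNorm_bounds hd hR hv hw
  obtain ⟨R₂, hR₂, h₂⟩ := exists_sumNorm_bounds hd hR hw hv
  generalize 2 ^ (m + 4) * d ^ (m + 2) = D at h₁ h₂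
  have hb0 : 0 < ‖b‖ := norm_pos_iff.2 hb
  have hρ : 1 < ‖a‖ / ‖b‖ := by rwa [one_lt_div hb0]
  set ρ := ‖a‖ / ‖b‖ with hρdef
  -- This puts both sides in base `ρ`, so that exponents can be compared.
  obtain ⟨N, hN⟩ := pow_unbounded_of_one_lt (R₁ * R₂) hρ
  refine ⟨(N + 1) * D, fun n i hi => ?_⟩
  obtain ⟨W, hW, hWeq, hhom, hc⟩ := controlled_of_mem_pow hd hR hSc n _ hi
  obtain ⟨hA, hAi⟩ := ofSL_pow_eq A i
  have hsame : SameMap W (linearTuple (A.1 ^ i)) :=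
    (Bir.mk_eq_mk hW hA).1 (hWeq.symm.trans hAi)
  have hid := hsame.bind₁_linearForm v w
  rw [bind₁_linearTuple, bind₁_linearTuple, vecMul_pow_of_eigen hva, vecMul_pow_of_eigen hwb,
    linearForm_smul, linearForm_smul, mul_left_comm, mul_left_comm _ (C (a ^ i))] at hid
  have hnorm := congrArg sumNorm hid
  rw [sumNorm_C_mul, sumNorm_C_mul, norm_pow, norm_pow] at hnorm
  have h1 := (h₁ n W hhom hc).1
  have h2 := (h₂ n W hhom hc).2
  set x := sumNorm (bind₁ W (linearForm v) * linearForm w)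
  set y := sumNorm (bind₁ W (linearForm w) * linearForm v)
  have hx : ρ ^ i * y = x := by
    rw [hρdef, div_pow, div_mul_eq_mul_div, ← hnorm, mul_div_cancel_left₀ _ (pow_pos hb0 i).ne']
  have hρi : ρ ^ i ≤ ρ ^ (N * D ^ (n + 1)) := by
    calc ρ ^ i = ρ ^ i * 1 := (mul_one _).symm
      _ ≤ ρ ^ i * (R₂ ^ D ^ (n + 1) * y) := by gcongr
      _ = R₂ ^ D ^ (n + 1) * x := by rw [← hx]; ring
      _ ≤ R₂ ^ D ^ (n + 1) * R₁ ^ D ^ (n + 1) := by gcongr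
      _ = (R₁ * R₂) ^ D ^ (n + 1) := by rw [mul_pow, mul_comm]
      _ ≤ (ρ ^ N) ^ D ^ (n + 1) := by gcongr
      _ = _ := (pow_mul _ _ _).symm
  have := (pow_le_pow_iff_right₀ hρ).1 hρi
  refine this.trans ?_
  rw [mul_pow]
  exact Nat.mul_le_mul_right _ ((Nat.le_succ N).trans (Nat.le_self_pow (by omega) _))

/-- Here cross-multiplication gives `i * (W*v · v) = W*w · v - W*v · w`. Only `i` itself, not an
exponential of `i`, appears as a scalar, hence the extra exponential; `hL` is what recovers `i` from
its norm. -/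
theorem exists_le_pow_pow_of_shift (hL : ∀ i : ℕ, ‖(i : L)‖ = i)
    (A : Matrix.SpecialLinearGroup (Fin (m + 1)) L)
    {S : Set (Bir L m)} (hS : S.Finite) {v w : Fin (m + 1) → L} (hv : v ≠ 0)
    (hva : v ᵥ* A.1 = v) (hwb : w ᵥ* A.1 = w + v) :
    ∃ R : ℝ, 1 ≤ R ∧ ∃ D : ℕ, 1 ≤ D ∧
      ∀ n i : ℕ, ofSL A ^ i ∈ S ^ n → (i : ℝ) ≤ R ^ D ^ (n + 1) := by
  have hw : w ≠ 0 := by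
    rintro rfl
    rw [zero_vecMul, zero_add] at hwb
    exact hv hwb.symm
  obtain ⟨d, hd, R, hR, hSc⟩ := exists_controlled_of_finite hS
  obtain ⟨R₁, hR₁, h₁⟩ := exists_sumNorm_bounds hd hR hv hw
  obtain ⟨R₂, hR₂, h₂⟩ := exists_sumNorm_bounds hd hR hw hv
  obtain ⟨R₃, hR₃, h₃⟩ := exists_sumNorm_bounds hd hR hv hv
  have hD : 1 ≤ 2 ^ (m + 4) * d ^ (m + 2) := Nat.succ_le_of_lt (by positivity)
  generalize 2 ^ (m + 4) * d ^ (m + 2) = D at hD h₁ h₂ h₃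
  refine ⟨(R₁ + R₂) * R₃, one_le_mul_of_one_le_of_one_le (by linarith) hR₃, D, hD,
    fun n i hi => ?_⟩
  obtain ⟨W, hW, hWeq, hhom, hc⟩ := controlled_of_mem_pow hd hR hSc n _ hi
  obtain ⟨hA, hAi⟩ := ofSL_pow_eq A i
  have hsame : SameMap W (linearTuple (A.1 ^ i)) :=
    (Bir.mk_eq_mk hW hA).1 (hWeq.symm.trans hAi)
  have hid := hsame.bind₁_linearForm v w
  have hvi : v ᵥ* A.1 ^ i = v := by
    have := vecMul_pow_of_eigen (a := 1) (hva.trans (one_smul _ _).symm) i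
    rwa [one_pow, one_smul] at this
  rw [bind₁_linearTuple, bind₁_linearTuple, vecMul_pow_of_shift hva hwb, hvi,
    linearForm_add, linearForm_smul] at hid
  have hid2 : C (i : L) * (bind₁ W (linearForm v) * linearForm v)
      = bind₁ W (linearForm w) * linearForm v - bind₁ W (linearForm v) * linearForm w := by
    rw [← hid]
    ring
  have hnorm := congrArg sumNorm hid2
  rw [sumNorm_C_mul, hL] at hnorm
  have hsub := sumNorm_sub_le (bind₁ W (linearForm w) * linearForm v)
    (bind₁ W (linearForm v) * linearForm w)
  rw [← hnorm] at hsub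
  have h1 := (h₁ n W hhom hc).1
  have h2 := (h₂ n W hhom hc).1
  have h3 := (h₃ n W hhom hc).2
  set E := D ^ (n + 1) with hE
  have hE0 : E ≠ 0 := by positivity
  have hadd : R₁ ^ E + R₂ ^ E ≤ (R₁ + R₂) ^ E :=
    pow_add_pow_le (by linarith) (by linarith) hE0
  set z := sumNorm (bind₁ W (linearForm v) * linearForm v)
  calc (i : ℝ) = i * 1 := (mul_one _).symm
    _ ≤ i * (R₃ ^ E * z) := by gcongr
    _ = (i * z) * R₃ ^ E := by ring
    _ ≤ (R₁ + R₂) ^ E * R₃ ^ E := by gcongr; linarith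
    _ = _ := (mul_pow _ _ _).symm

end Bounds

end Cremona

namespace Cremona

open MvPolynomial

/-! ### Base change and descent to a countable field -/

section BaseChange

variable {K K' : Type*} [Field K] [Field K'] {m : ℕ}

/-- Base change of a tuple of polynomials. -/
noncomputable def Tuple.map (f : K →+* K') (F : Tuple K m) : Tuple K' m :=
  fun i => MvPolynomial.map f (F i)

theorem Tuple.map_injective (f : K →+* K') :
    Function.Injective (Tuple.map f : Tuple K m → Tuple K' m) := fun _ _ h =>
  funext fun i => MvPolynomial.map_injective f f.injective (congrFun h i)

theorem Tuple.map_zero (f : K →+* K') : Tuple.map f (0 : Tuple K m) = 0 :=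
  funext fun _ => _root_.map_zero _

theorem Tuple.map_ne_zero (f : K →+* K') {F : Tuple K m} : F.map f ≠ 0 ↔ F ≠ 0 := by
  rw [← (Tuple.map_injective f).ne_iff, Tuple.map_zero]

theorem Tuple.map_comp (f : K →+* K') (F G : Tuple K m) :
    (comp F G).map f = comp (F.map f) (G.map f) :=
  funext fun _ => map_bind₁ _ _ _

theorem Tuple.map_X (f : K →+* K') : Tuple.map f (X : Tuple K m) = X :=
  funext fun _ => MvPolynomial.map_X _ _

theorem sameMap_map_iff (f : K →+* K') {F G : Tuple K m} :
    SameMap (F.map f) (G.map f) ↔ SameMap F G := by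
  simp only [SameMap, Tuple.map, ← map_mul, (MvPolynomial.map_injective f f.injective).eq_iff]

theorem isHomogeneous_map_iff {σ : Type*} (f : K →+* K') {P : MvPolynomial σ K} {d : ℕ} :
    (MvPolynomial.map f P).IsHomogeneous d ↔ P.IsHomogeneous d := by
  simp only [IsHomogeneous, IsWeightedHomogeneous, coeff_map, map_ne_zero]

theorem isRational_map_iff (f : K →+* K') {F : Tuple K m} :
    IsRational (F.map f) ↔ IsRational F := by
  simp only [IsRational, Tuple.map_ne_zero, Tuple.map, isHomogeneous_map_iff]

theorem isLeftInverse_map_iff (f : K →+* K') {F G : Tuple K m} :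
    IsLeftInverse (F.map f) (G.map f) ↔ IsLeftInverse F G := by
  unfold IsLeftInverse
  rw [← Tuple.map_comp, Tuple.map_ne_zero, ← Tuple.map_X f, sameMap_map_iff]

theorem IsBirational.map (f : K →+* K') {F : Tuple K m} (hF : IsBirational F) :
    IsBirational (F.map f) := by
  obtain ⟨hF, G, hG, h, h'⟩ := hF
  exact ⟨(isRational_map_iff f).2 hF, G.map f, (isRational_map_iff f).2 hG,
    (isLeftInverse_map_iff f).2 h, (isLeftInverse_map_iff f).2 h'⟩

/-- Base change of birational transformations. -/
noncomputable def Bir.map (f : K →+* K') : Bir K m →* Bir K' m where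
  toFun := Quotient.map (fun F => ⟨F.1.map f, F.2.map f⟩) fun _ _ h => (sameMap_map_iff f).2 h
  map_one' := congrArg (Quotient.mk _) (Subtype.ext (Tuple.map_X f))
  map_mul' := by
    rintro ⟨F⟩ ⟨G⟩
    exact congrArg (Quotient.mk _) (Subtype.ext (Tuple.map_comp f F.1 G.1))

theorem Bir.map_injective (f : K →+* K') :
    Function.Injective (Bir.map f : Bir K m →* Bir K' m) := by
  rintro ⟨F⟩ ⟨G⟩ h
  exact Quotient.sound ((sameMap_map_iff f).1 (Quotient.exact h))

theorem Bir.map_ofSL (f : K →+* K') (A : Matrix.SpecialLinearGroup (Fin (m + 1)) K) :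
    Bir.map f (ofSL A) = ofSL (Matrix.SpecialLinearGroup.map f A) := by
  refine congrArg (Quotient.mk _) (Subtype.ext (funext fun i => ?_))
  simp [Tuple.map, linearTuple]

/-- The coefficients of a tuple of polynomials. -/
def Tuple.coeffs (F : Tuple K m) : Set K := ⋃ i, ((F i).coeffs : Set K)

theorem Tuple.finite_coeffs (F : Tuple K m) : F.coeffs.Finite :=
  Set.finite_iUnion fun _ => Finset.finite_toSet _

theorem Tuple.exists_map_eq (K₀ : Subfield K) {F : Tuple K m} (h : F.coeffs ⊆ K₀) :
    ∃ G : Tuple K₀ m, G.map K₀.subtype = F := by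
  have h1 : ∀ i, ∃ P : MvPolynomial (Fin (m + 1)) K₀, MvPolynomial.map K₀.subtype P = F i :=
    fun i => by
      have : F i ∈ Set.range (MvPolynomial.map K₀.subtype) :=
        mem_range_map_iff_coeffs_subset.2 fun a ha =>
          ⟨⟨a, h (Set.mem_iUnion.2 ⟨i, ha⟩)⟩, rfl⟩
      exact this
  choose G hG using h1
  exact ⟨G, funext hG⟩

/-- The coefficients of an inverse are included, so that birationality descends along with the
tuple. -/
theorem Bir.exists_finite_forall_mem_range (g : Bir K m) :
    ∃ E : Set K, E.Finite ∧ ∀ K₀ : Subfield K, E ⊆ K₀ →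
      g ∈ (Bir.map K₀.subtype : Bir K₀ m →* Bir K m).range := by
  obtain ⟨⟨F, hF, G, hG, h, h'⟩, rfl⟩ := Quotient.exists_rep g
  refine ⟨F.coeffs ∪ G.coeffs, F.finite_coeffs.union G.finite_coeffs, fun K₀ hK₀ => ?_⟩
  obtain ⟨F₀, rfl⟩ := Tuple.exists_map_eq K₀ (Set.subset_union_left.trans hK₀)
  obtain ⟨G₀, rfl⟩ := Tuple.exists_map_eq K₀ (Set.subset_union_right.trans hK₀)
  exact ⟨Bir.mk F₀ ⟨(isRational_map_iff _).1 hF, G₀, (isRational_map_iff _).1 hG,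
    (isLeftInverse_map_iff _).1 h, (isLeftInverse_map_iff _).1 h'⟩, rfl⟩

/-- Finitely many birational transformations and finitely many scalars are defined over a countable
subfield. -/
theorem exists_countable_subfield {S : Set (Bir K m)} (hS : S.Finite) {E : Set K}
    (hE : E.Finite) : ∃ K₀ : Subfield K, Countable K₀ ∧ E ⊆ K₀ ∧
      ∃ S₀ : Set (Bir K₀ m), S₀.Finite ∧ Bir.map K₀.subtype '' S₀ = S := by
  choose T hT hTr using fun g : Bir K m => g.exists_finite_forall_mem_range
  have hfin : (E ∪ ⋃ g ∈ S, T g).Finite := hE.union (hS.biUnion fun g _ => hT g)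
  have hsub := Subfield.subset_closure (s := E ∪ ⋃ g ∈ S, T g)
  refine ⟨Subfield.closure (E ∪ ⋃ g ∈ S, T g), ?_, Set.subset_union_left.trans hsub, ?_⟩
  · have := hfin.countable.to_subtype
    have := Subfield.cardinalMk_closure_le_max (E ∪ ⋃ g ∈ S, T g)
    rw [← Cardinal.mk_le_aleph0_iff]
    refine this.trans (max_le ?_ le_rfl)
    exact Cardinal.mk_le_aleph0_iff.2 inferInstance
  · refine ⟨Bir.map _ ⁻¹' S, hS.preimage (Bir.map_injective _).injOn,
      Set.image_preimage_eq_of_subset fun g hg => hTr g _ ?_⟩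
    exact ((Set.subset_biUnion_of_mem (u := T) hg).trans Set.subset_union_right).trans hsub

end BaseChange

end Cremona

/-! ### Embeddings of countable fields in normed fields -/

namespace Cremona

open Polynomial

/-- A transcendence basis of `K` over the countable ring `R` is countable, while one of `L` is
infinite. Inject the former in the latter, then extend over the algebraic part since `L` is
algebraically closed. -/
theorem exists_algHom_of_countable {R K L : Type*} [CommRing R] [IsDomain R] [Field K] [Field L]
    [IsAlgClosed L] [Algebra R K] [Algebra R L] [FaithfulSMul R K] [FaithfulSMul R L]
    [Countable K] [Uncountable L] : Nonempty (K →ₐ[R] L) := by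
  have hR : Countable R := (FaithfulSMul.algebraMap_injective R K).countable
  obtain ⟨s, hs⟩ := exists_isTranscendenceBasis R K
  obtain ⟨t, ht⟩ := exists_isTranscendenceBasis R L
  have hsc : Countable s := inferInstance
  have htu : Cardinal.mk t = Cardinal.mk L := by
    have := IsAlgClosed.cardinal_eq_cardinal_transcendence_basis_of_aleph0_lt _ ht
      (Cardinal.mk_le_aleph0_iff.2 hR) (Cardinal.aleph0_lt_mk_iff.2 inferInstance)
    simpa using this.symm
  have ht' : Infinite t := by
    rw [Cardinal.infinite_iff, htu]
    exact (Cardinal.aleph0_lt_mk_iff.2 inferInstance).le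
  obtain ⟨f, hf⟩ := exists_injective_nat s
  let e : s → t := fun x => Infinite.natEmbedding t (f x)
  have he : Function.Injective e := (Infinite.natEmbedding t).injective.comp hf
  have hind : AlgebraicIndependent R fun x : s => ((e x : t) : L) := ht.1.comp e he
  let φ : Algebra.adjoin R (Set.range ((↑) : s → K)) →ₐ[R] L :=
    (MvPolynomial.aeval fun x : s => ((e x : t) : L)).comp (hs.1.aevalEquiv.symm : _ →ₐ[R] _)
  have hφ : Function.Injective φ :=
    fun _ _ h => hs.1.aevalEquiv.symm.injective (algebraicIndependent_iff_injective_aeval.1 hind h)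
  let _ : Algebra (Algebra.adjoin R (Set.range ((↑) : s → K))) L := φ.toRingHom.toAlgebra
  have : FaithfulSMul (Algebra.adjoin R (Set.range ((↑) : s → K))) L :=
    (faithfulSMul_iff_algebraMap_injective _ _).2 hφ
  have := hs.isAlgebraic
  have : IsScalarTower R (Algebra.adjoin R (Set.range ((↑) : s → K))) L :=
    IsScalarTower.of_algebraMap_eq fun r => (φ.commutes r).symm
  exact ⟨(IsAlgClosed.lift : K →ₐ[Algebra.adjoin R (Set.range ((↑) : s → K))] L).restrictScalars R⟩

theorem uncountable_of_complete (𝕜 : Type*) [NontriviallyNormedField 𝕜] [CompleteSpace 𝕜] :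
    Uncountable 𝕜 := by
  rw [← Cardinal.aleph0_lt_mk_iff]
  exact Cardinal.aleph0_lt_continuum.trans_le (continuum_le_cardinal_of_nontriviallyNormedField 𝕜)

instance uncountable_complex : Uncountable ℂ := uncountable_of_complete ℂ

instance uncountable_padicAlgCl (p : ℕ) [Fact p.Prime] : Uncountable (PadicAlgCl p) :=
  have := uncountable_of_complete ℚ_[p]
  (algebraMap ℚ_[p] (PadicAlgCl p)).injective.uncountable

/-- An algebraic number can be mapped to any of its conjugates. -/
theorem exists_ringHom_of_aeval_minpoly {K L : Type*} [Field K] [Field L] [CharZero K] [CharZero L]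
    [IsAlgClosed L] [Countable K] [Uncountable L] {x : K} (hx : IsIntegral ℚ x) {z : L}
    (hz : aeval z (minpoly ℚ x) = 0) : ∃ f : K →+* L, f x = z := by
  have : Fact (Irreducible (minpoly ℚ x)) := ⟨minpoly.irreducible hx⟩
  let _ : Algebra (AdjoinRoot (minpoly ℚ x)) K :=
    (AdjoinRoot.lift (algebraMap ℚ K) x (minpoly.aeval ℚ x)).toAlgebra
  let _ : Algebra (AdjoinRoot (minpoly ℚ x)) L :=
    (AdjoinRoot.lift (algebraMap ℚ L) z hz).toAlgebra
  obtain ⟨f⟩ := exists_algHom_of_countable (R := AdjoinRoot (minpoly ℚ x)) (K := K) (L := L)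
  have h := f.commutes (AdjoinRoot.root _)
  refine ⟨f, ?_⟩
  have h1 : algebraMap (AdjoinRoot (minpoly ℚ x)) K (AdjoinRoot.root _) = x :=
    AdjoinRoot.lift_root (minpoly.aeval ℚ x)
  have h2 : algebraMap (AdjoinRoot (minpoly ℚ x)) L (AdjoinRoot.root _) = z :=
    AdjoinRoot.lift_root hz
  rw [h1, h2] at h
  exact h

theorem exists_ringHom_of_transcendental {K L : Type*} [Field K] [Field L] [CharZero K] [CharZero L]
    [IsAlgClosed L] [Countable K] [Uncountable L] {x : K} (hx : Transcendental ℚ x) {z : L}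
    (hz : Transcendental ℚ z) : ∃ f : K →+* L, f x = z := by
  let _ : Algebra ℚ[X] K := (aeval (R := ℚ) x).toRingHom.toAlgebra
  let _ : Algebra ℚ[X] L := (aeval (R := ℚ) z).toRingHom.toAlgebra
  have : FaithfulSMul ℚ[X] K := (faithfulSMul_iff_algebraMap_injective _ _).2
    (transcendental_iff_injective.1 hx)
  have : FaithfulSMul ℚ[X] L := (faithfulSMul_iff_algebraMap_injective _ _).2
    (transcendental_iff_injective.1 hz)
  obtain ⟨f⟩ := exists_algHom_of_countable (R := ℚ[X]) (K := K) (L := L)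
  have h := f.commutes X
  refine ⟨f, ?_⟩
  rw [RingHom.algebraMap_toAlgebra, RingHom.algebraMap_toAlgebra] at h
  simpa using h

theorem exists_transcendental_norm_ne_one : ∃ z : ℂ, Transcendental ℚ z ∧ ‖z‖ ≠ 1 := by
  obtain ⟨z, hz⟩ : ∃ z : ℂ, Transcendental ℚ z := by
    by_contra! h
    have hc := Algebraic.countable ℚ ℂ
    rw [Set.eq_univ_of_forall (s := {x : ℂ | IsAlgebraic ℚ x}) fun z => not_not.1 (h z)] at hc
    exact not_countable (Set.countable_univ_iff.1 hc)
  by_cases h : ‖z‖ = 1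
  · refine ⟨2 * z, fun h2 => hz ?_, by simp [h]⟩
    have : z = algebraMap ℚ ℂ 2⁻¹ * (2 * z) := by simp
    rw [this]
    exact (isAlgebraic_algebraMap (2⁻¹ : ℚ)).mul h2
  · exact ⟨z, hz, h⟩

theorem Rat.den_eq_one_of_norm_le_one {r : ℚ}
    (h : ∀ (p : ℕ) [Fact p.Prime], ‖(r : ℚ_[p])‖ ≤ 1) : r.den = 1 := by
  by_contra hd
  obtain ⟨p, hp, hpd⟩ := Nat.exists_prime_and_dvd hd
  have : Fact p.Prime := ⟨hp⟩
  have h1 : (r : ℚ_[p]) * ((r.den : ℤ) : ℚ_[p]) = ((r.num : ℤ) : ℚ_[p]) := by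
    have := Rat.mul_den_eq_num r
    exact_mod_cast this
  have h2 : ‖((r.den : ℤ) : ℚ_[p])‖ < 1 :=
    Padic.norm_intCast_lt_one_iff.2 (Int.natCast_dvd_natCast.2 hpd)
  have h3 : ‖((r.num : ℤ) : ℚ_[p])‖ < 1 := by
    rw [← h1, norm_mul]
    exact (mul_le_of_le_one_left (norm_nonneg _) (h p)).trans_lt h2
  have h4 := Padic.norm_intCast_lt_one_iff.1 h3
  have h5 := Nat.dvd_gcd (Int.natCast_dvd.1 h4) hpd
  rw [r.reduced.gcd_eq_one] at h5
  exact hp.one_lt.ne' (Nat.dvd_one.1 h5)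

/-- All linear factors of `P` have coefficients in the valuation ring, hence so does their product.
-/
theorem norm_coeff_le_one_of_roots {p : ℕ} [Fact p.Prime] {P : ℚ[X]} (hP : P.Monic)
    (h : ∀ z : PadicAlgCl p, aeval z P = 0 → ‖z‖ ≤ 1) (i : ℕ) : ‖(P.coeff i : ℚ_[p])‖ ≤ 1 := by
  set f := algebraMap ℚ (PadicAlgCl p)
  set O := (Valued.v : Valuation (PadicAlgCl p) ℝ≥0).integer with hO
  have hmem : ∀ z : PadicAlgCl p, z ∈ O ↔ ‖z‖ ≤ 1 := fun z => Iff.rfl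
  have hlift : P.map f ∈ Polynomial.lifts O.subtype := by
    rw [(IsAlgClosed.splits (P.map f)).eq_prod_roots_of_monic (hP.map f)]
    refine multiset_prod_mem _ fun Q hQ => ?_
    obtain ⟨r, hr, rfl⟩ := Multiset.mem_map.1 hQ
    have hr1 : ‖r‖ ≤ 1 := h r (by
      have := (mem_roots'.1 hr).2
      rwa [IsRoot.def, eval_map_algebraMap] at this)
    exact ⟨X - C ⟨r, (hmem r).2 hr1⟩, by simp⟩
  obtain ⟨y, hy⟩ := (Polynomial.lifts_iff_coeff_lifts _).1 hlift i
  have h1 : ‖f (P.coeff i)‖ ≤ 1 := by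
    rw [← coeff_map, ← hy]
    exact y.2
  have h2 : f (P.coeff i) = algebraMap ℚ_[p] (PadicAlgCl p) (P.coeff i : ℚ_[p]) := by simp [f]
  rwa [h2, PadicAlgCl.norm_extends] at h1

/-- An element of a countable field of characteristic zero which is not a root of unity has an
absolute value different from `1` for some embedding in a normed field. -/
theorem exists_ringHom_norm_ne_one {K : Type*} [Field K] [CharZero K] [Countable K] {x : K}
    (hx : ∀ n : ℕ, 0 < n → x ^ n ≠ 1) :
    ∃ (L : Type) (_ : NormedField L) (f : K →+* L), ‖f x‖ ≠ 1 := by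
  by_contra! h
  by_cases halg : Transcendental ℚ x
  -- A transcendental element can be sent to any transcendental number.
  · obtain ⟨z, hz, hz1⟩ := exists_transcendental_norm_ne_one
    obtain ⟨f, hf⟩ := exists_ringHom_of_transcendental halg hz
    exact hz1 (hf ▸ h ℂ inferInstance f)
  have hint : IsIntegral ℚ x := (not_not.1 halg).isIntegral
  -- Every `p`-adic conjugate of `x` is the image of `x` under some embedding, so it has norm `1`.
  -- Thus no prime divides a denominator, and `x` is an algebraic integer.
  have hden : ∀ i, ((minpoly ℚ x).coeff i).den = 1 := fun i =>
    Rat.den_eq_one_of_norm_le_one fun p _ =>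
      norm_coeff_le_one_of_roots (minpoly.monic hint) (fun z hz => by
        obtain ⟨f, hf⟩ := exists_ringHom_of_aeval_minpoly hint hz
        exact hf ▸ (h (PadicAlgCl p) inferInstance f).le) i
  have hintZ : IsIntegral ℤ x := by
    have hl : minpoly ℚ x ∈ Polynomial.lifts (algebraMap ℤ ℚ) :=
      (Polynomial.lifts_iff_coeff_lifts _).2 fun i =>
        ⟨((minpoly ℚ x).coeff i).num, Rat.den_eq_one_iff _ |>.1 (hden i)⟩
    obtain ⟨Q, hQ, -, hQm⟩ := lifts_and_natDegree_eq_and_monic hl (minpoly.monic hint)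
    refine ⟨Q, hQm, ?_⟩
    have := minpoly.aeval ℚ x
    rwa [← hQ, aeval_map_algebraMap] at this
  have : FiniteDimensional ℚ (IntermediateField.adjoin ℚ {x}) :=
    IntermediateField.adjoin.finiteDimensional hint
  have : NumberField (IntermediateField.adjoin ℚ {x}) := ⟨⟩
  set y := IntermediateField.AdjoinSimple.gen ℚ x
  have hyx : algebraMap (IntermediateField.adjoin ℚ {x}) K y = x := rfl
  have hy : IsIntegral ℤ y := by
    rw [← isIntegral_algebraMap_iff (algebraMap (IntermediateField.adjoin ℚ {x}) K).injective, hyx]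
    exact hintZ
  -- Kronecker's theorem: an algebraic integer all of whose complex conjugates have norm `1` is a
  -- root of unity.
  obtain ⟨n, hn, hyn⟩ := NumberField.Embeddings.pow_eq_one_of_norm_eq_one
    (IntermediateField.adjoin ℚ {x}) ℂ hy fun φ => by
      have hz : aeval (φ y) (minpoly ℚ x) = 0 := by
        have h1 : minpoly ℚ x = minpoly ℚ y := (IntermediateField.minpoly_gen ℚ x).symm
        rw [h1, show φ y = φ.toRatAlgHom y from rfl, aeval_algHom_apply, minpoly.aeval, map_zero]
      obtain ⟨f, hf⟩ := exists_ringHom_of_aeval_minpoly hint hz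
      exact hf ▸ h ℂ inferInstance f
  refine hx n hn ?_
  rw [← hyx, ← map_pow, hyn, map_one]

end Cremona

/-! ### From bounds on exponents to domination of the distortion function -/

namespace Distortion

variable {G : Type*} [Group G]

theorem dominated_expFun {c : G} {S : Set G} {B : ℕ}
    (h : ∀ n i : ℕ, c ^ i ∈ S ^ n → i ≤ B ^ (n + 1)) : Dominated (distortionFun c S) expFun := by
  have hB : (1 : ℝ) ≤ B + 1 := by linarith [B.cast_nonneg (α := ℝ)]
  have hlog : 0 ≤ Real.log (B + 1) := Real.log_nonneg hB
  -- The added `1`s keep the constants positive even when `B = 0`.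
  refine ⟨B + 1, ⟨Real.log (B + 1) + 1, by linarith⟩, 1, by positivity,
    NNReal.coe_pos.1 (add_pos_of_nonneg_of_pos hlog one_pos), one_pos, fun x => ?_⟩
  refine (iSup₂_le fun i hi => ?_).trans le_self_add
  have h1 : (i : ℝ) ≤ (B + 1) * Real.exp ((Real.log (B + 1) + 1) * x) := by
    have hx : (⌊x⌋₊ : ℝ) ≤ x := by exact_mod_cast Nat.floor_le x.2
    calc (i : ℝ) ≤ (B : ℝ) ^ (⌊x⌋₊ + 1) := by exact_mod_cast h _ _ hi
      _ ≤ (B + 1 : ℝ) ^ (⌊x⌋₊ + 1) := by gcongr; linarith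
      _ = (B + 1) * Real.exp (Real.log (B + 1) * ⌊x⌋₊) := by
        rw [pow_succ', mul_comm (Real.log _), Real.exp_nat_mul, Real.exp_log (by linarith)]
      _ ≤ _ := by
        gcongr
        linarith
  calc (i : ℝ≥0∞) = ENNReal.ofReal i := (ENNReal.ofReal_natCast i).symm
    _ ≤ ENNReal.ofReal ((B + 1) * Real.exp ((Real.log (B + 1) + 1) * x)) :=
      ENNReal.ofReal_le_ofReal h1
    _ = _ := by
      rw [ENNReal.ofReal_mul (by linarith), expFun]
      congr 1
      rw [ENNReal.ofReal_add (by positivity) zero_le_one]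
      simp

theorem dominated_expExpFun {c : G} {S : Set G} {R : ℝ} (hR : 1 ≤ R) {D : ℕ} (hD : 1 ≤ D)
    (h : ∀ n i : ℕ, c ^ i ∈ S ^ n → (i : ℝ) ≤ R ^ D ^ (n + 1)) :
    Dominated (distortionFun c S) expExpFun := by
  have hlogR : 0 ≤ Real.log R := Real.log_nonneg hR
  have hD' : (1 : ℝ) ≤ D := by exact_mod_cast hD
  set E : ℝ := D * (Real.log R + 1) * D with hE
  have hT : 1 ≤ D * (Real.log R + 1) := one_le_mul_of_one_le_of_one_le hD' (by linarith)
  have hE1 : 1 ≤ E := one_le_mul_of_one_le_of_one_le hT hD'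
  have hlogE : 0 ≤ Real.log E := Real.log_nonneg hE1
  refine ⟨1, ⟨Real.log E + 1, by linarith⟩, ⟨Real.exp E, (Real.exp_pos _).le⟩, one_pos,
    NNReal.coe_pos.1 (add_pos_of_nonneg_of_pos hlogE one_pos),
    NNReal.coe_pos.1 (Real.exp_pos _), fun x => ?_⟩
  refine iSup₂_le fun i hi => ?_
  have hx : (⌊x⌋₊ : ℝ) ≤ x := by exact_mod_cast Nat.floor_le x.2
  have h1 : (i : ℝ) ≤ Real.exp (Real.exp ((Real.log E + 1) * x)) + Real.exp E := by
    have h2 : (i : ℝ) ≤ Real.exp (D * (Real.log R + 1) * D ^ ⌊x⌋₊) := by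
      calc (i : ℝ) ≤ R ^ D ^ (⌊x⌋₊ + 1) := h _ _ hi
        _ = Real.exp (D * Real.log R * D ^ ⌊x⌋₊) := by
          rw [← Real.exp_log (show 0 < R ^ D ^ (⌊x⌋₊ + 1) by positivity), Real.log_pow]
          push_cast
          rw [pow_succ]
          ring_nf
        _ ≤ _ := by
          gcongr
          linarith
    -- A constant factor inside the outer exponential must be absorbed by rescaling `x`: for `⌊x⌋₊ ≥
    -- 1` it is at most its own `⌊x⌋₊`-th power. The remaining case is covered by the additive
    -- constant `exp E`.
    rcases Nat.eq_zero_or_pos ⌊x⌋₊ with h0 | h0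
    · rw [h0, pow_zero, mul_one] at h2
      refine h2.trans (le_add_of_nonneg_of_le (Real.exp_pos _).le (Real.exp_le_exp.2 ?_))
      exact le_mul_of_one_le_right (by linarith) hD'
    · refine h2.trans (le_add_of_le_of_nonneg (Real.exp_le_exp.2 ?_) (Real.exp_pos _).le)
      calc D * (Real.log R + 1) * D ^ ⌊x⌋₊ ≤ (D * (Real.log R + 1)) ^ ⌊x⌋₊ * (D : ℝ) ^ ⌊x⌋₊ := by
            gcongr
            exact le_self_pow₀ hT h0.ne'
        _ = Real.exp (Real.log E * ⌊x⌋₊) := by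
          rw [← mul_pow, mul_comm (Real.log _), Real.exp_nat_mul, Real.exp_log (by linarith)]
        _ ≤ _ := by
          gcongr
          linarith
  calc (i : ℝ≥0∞) = ENNReal.ofReal i := (ENNReal.ofReal_natCast i).symm
    _ ≤ ENNReal.ofReal (Real.exp (Real.exp ((Real.log E + 1) * x)) + Real.exp E) :=
      ENNReal.ofReal_le_ofReal h1
    _ = _ := by
      rw [ENNReal.ofReal_add (Real.exp_pos _).le (Real.exp_pos _).le, ENNReal.coe_one, one_mul,
        expExpFun]
      congr 1
      exact ENNReal.ofReal_eq_coe_nnreal _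

end Distortion

namespace Cremona

open Matrix

/-! ### Eigenvalues, and matrices that are not virtually unipotent -/

section Eigen

variable {K : Type*} [Field K] {m : ℕ}

theorem exists_vecMul_eq_smul {A : Matrix (Fin (m + 1)) (Fin (m + 1)) K} {a : K}
    (h : A.charpoly.IsRoot a) : ∃ v ≠ 0, v ᵥ* A = a • v := by
  rw [Polynomial.IsRoot.def, eval_charpoly] at h
  obtain ⟨v, hv, hv0⟩ := exists_vecMul_eq_zero_iff.2 h
  refine ⟨v, hv, ?_⟩
  rw [vecMul_sub, sub_eq_zero] at hv0
  rw [← hv0, scalar_apply, ← smul_one_eq_diagonal, vecMul_smul, vecMul_one]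

/-- A nonzero nilpotent matrix has a Jordan block of size at least two. -/
theorem exists_vecMul_eq_of_isNilpotent {B : Matrix (Fin (m + 1)) (Fin (m + 1)) K}
    (hB : IsNilpotent B) (hB0 : B ≠ 0) : ∃ v w, v ≠ 0 ∧ w ᵥ* B = v ∧ v ᵥ* B = 0 := by
  set n := nilpotencyClass B with hn
  have h1 : 2 ≤ n := by
    by_contra! h
    have : B ^ 1 = 0 := pow_eq_zero_of_le (by omega : n ≤ 1) (pow_nilpotencyClass hB)
    exact hB0 (by rwa [pow_one] at this)
  have h2 : B ^ (n - 1) ≠ 0 := pow_pred_nilpotencyClass hB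
  obtain ⟨u, hu⟩ : ∃ u, u ᵥ* B ^ (n - 1) ≠ 0 := by
    by_contra! h
    refine h2 (Matrix.ext fun i j => ?_)
    have := congrFun (h (Pi.single i 1)) j
    simpa using this
  refine ⟨u ᵥ* B ^ (n - 1), u ᵥ* B ^ (n - 2), hu, ?_, ?_⟩
  · rw [vecMul_vecMul, ← pow_succ]
    congr 2
    omega
  · rw [vecMul_vecMul, ← pow_succ, show n - 1 + 1 = n by omega, pow_nilpotencyClass hB, vecMul_zero]

/-- If all ratios of eigenvalues were roots of unity, all eigenvalues would have the same `N`-th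
power for some `N`; determinant `1` makes that power a root of unity, so some power of `A` has `1`
as its only eigenvalue. -/
theorem exists_roots_of_not_isVirtuallyUnipotent [IsAlgClosed K]
    (A : Matrix.SpecialLinearGroup (Fin (m + 1)) K) (hA : ¬ IsVirtuallyUnipotent A.1) :
    ∃ a b : K, A.1.charpoly.IsRoot a ∧ A.1.charpoly.IsRoot b ∧ a ≠ 0 ∧ b ≠ 0 ∧
      ∀ n : ℕ, 0 < n → (a / b) ^ n ≠ 1 := by
  by_contra! h
  apply hA
  have hmonic := A.1.charpoly_monic
  have hroot : ∀ {a}, a ∈ A.1.charpoly.roots → A.1.charpoly.IsRoot a := fun ha =>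
    (Polynomial.mem_roots'.1 ha).2
  have hdet : A.1.charpoly.roots.prod = 1 := by
    rw [← det_eq_prod_roots_charpoly, A.2]
  have hne : ∀ a ∈ A.1.charpoly.roots, a ≠ 0 := by
    rintro a ha rfl
    rw [Multiset.prod_eq_zero ha] at hdet
    exact zero_ne_one hdet
  have hcard : A.1.charpoly.roots.card = m + 1 := by
    rw [← (IsAlgClosed.splits A.1.charpoly).natDegree_eq_card_roots, charpoly_natDegree_eq_dim,
      Fintype.card_fin]
  obtain ⟨b, hb⟩ := Multiset.card_pos_iff_exists_mem.1 (by omega : 0 < A.1.charpoly.roots.card)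
  have hb0 := hne b hb
  have hn : ∀ a ∈ A.1.charpoly.roots, ∃ n : ℕ, 0 < n ∧ (a / b) ^ n = 1 := fun a ha =>
    h a b (hroot ha) (hroot hb) (hne a ha) hb0
  choose! n hn0 hn1 using hn
  classical
  set N := ∏ a ∈ A.1.charpoly.roots.toFinset, n a with hN
  have hN0 : 0 < N := Finset.prod_pos fun a ha => hn0 a (Multiset.mem_toFinset.1 ha)
  have haN : ∀ a ∈ A.1.charpoly.roots, a ^ N = b ^ N := fun a ha => by
    obtain ⟨l, hl⟩ := Finset.dvd_prod_of_mem n (Multiset.mem_toFinset.2 ha)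
    have : (a / b) ^ N = 1 := by rw [hN, hl, pow_mul, hn1 a ha, one_pow]
    rwa [div_pow, div_eq_one_iff_eq (pow_ne_zero _ hb0)] at this
  have hbN : b ^ (N * (m + 1)) = 1 := by
    have h1 : (A.1.charpoly.roots.map fun a => a ^ N).prod = 1 := by
      rw [Multiset.prod_map_pow, Multiset.map_id', hdet, one_pow]
    rw [Multiset.map_congr rfl haN, Multiset.map_const', Multiset.prod_replicate, hcard,
      ← pow_mul] at h1
    exact h1
  refine ⟨N * (m + 1), by positivity, m + 1, ?_⟩
  -- With Cayley–Hamilton, this divisibility gives the nilpotency of `A ^ (N * (m + 1)) - 1`.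
  have hdvd : A.1.charpoly ∣ (Polynomial.X ^ (N * (m + 1)) - 1) ^ (m + 1) := by
    rw [(IsAlgClosed.splits A.1.charpoly).eq_prod_roots_of_monic hmonic]
    refine (Multiset.prod_dvd_prod_of_dvd _
      (fun _ => (Polynomial.X ^ (N * (m + 1)) - 1 : Polynomial K)) fun a ha => ?_).trans ?_
    · rw [Polynomial.dvd_iff_isRoot]
      simp [pow_mul, haN a ha, ← hbN]
    · rw [Multiset.map_const', Multiset.prod_replicate, hcard]
  obtain ⟨Q, hQ⟩ := hdvd
  have := congrArg (Polynomial.aeval A.1) hQ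
  rw [map_mul, aeval_self_charpoly, zero_mul] at this
  simpa using this

theorem exists_specialLinearGroup_map_eq (K₀ : Subfield K)
    (A : Matrix.SpecialLinearGroup (Fin (m + 1)) K) (hA : ∀ i j, A.1 i j ∈ K₀) :
    ∃ A₀ : Matrix.SpecialLinearGroup (Fin (m + 1)) K₀,
      Matrix.SpecialLinearGroup.map K₀.subtype A₀ = A := by
  have h : K₀.subtype.mapMatrix (Matrix.of fun i j => ⟨A.1 i j, hA i j⟩) = A.1 := by
    ext i j
    rfl
  refine ⟨⟨Matrix.of fun i j => ⟨A.1 i j, hA i j⟩, ?_⟩, Subtype.ext h⟩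
  apply K₀.subtype.injective
  rw [RingHom.map_det, h, A.2, map_one]

theorem charpoly_map_isRoot_iff {K' : Type*} [Field K'] (f : K →+* K')
    (A : Matrix.SpecialLinearGroup (Fin (m + 1)) K) (a : K) :
    (Matrix.SpecialLinearGroup.map f A).1.charpoly.IsRoot (f a) ↔ A.1.charpoly.IsRoot a := by
  have : (Matrix.SpecialLinearGroup.map f A).1 = A.1.map f := rfl
  rw [this, charpoly_map, Polynomial.IsRoot.def, Polynomial.IsRoot.def, Polynomial.eval_map,
    Polynomial.eval₂_hom, map_eq_zero]

theorem coe_map_pow_sub_one {K' : Type*} [Field K'] (f : K →+* K')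
    (A : Matrix.SpecialLinearGroup (Fin (m + 1)) K) (r : ℕ) :
    (Matrix.SpecialLinearGroup.map f A).1 ^ r - 1 = f.mapMatrix (A.1 ^ r - 1) := by
  rw [map_sub, map_pow, map_one]
  rfl

end Eigen

/-! ### Upper bounds over an arbitrary field of characteristic zero -/

section Upper

variable {k : Type*} [Field k] [CharZero k] {m : ℕ}

theorem Bir.map_pow_mem {K K' : Type*} [Field K] [Field K'] (f : K →+* K')
    {A : Matrix.SpecialLinearGroup (Fin (m + 1)) K} {S : Set (Bir K m)} {n i : ℕ} :
    ofSL (Matrix.SpecialLinearGroup.map f A) ^ i ∈ (Bir.map f '' S) ^ n ↔ ofSL A ^ i ∈ S ^ n := by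
  rw [← Bir.map_ofSL, ← map_pow, ← Set.image_pow, (Bir.map_injective f).mem_set_image]

/-- The matrix, the set `S` and two eigenvalues with ratio of infinite order descend to a countable
field, which is then embedded so that this ratio has norm different from `1`. The roles of the two
eigenvalues depend on which norm is larger. -/
theorem exists_le_pow [IsAlgClosed k] (A : Matrix.SpecialLinearGroup (Fin (m + 1)) k)
    (hA : ¬ IsVirtuallyUnipotent A.1) {S : Set (Bir k m)} (hS : S.Finite) :
    ∃ B : ℕ, ∀ n i : ℕ, ofSL A ^ i ∈ S ^ n → i ≤ B ^ (n + 1) := by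
  obtain ⟨a, b, ha, hb, ha0, hb0, hab⟩ := exists_roots_of_not_isVirtuallyUnipotent A hA
  obtain ⟨K, hKc, hE, S₀, hS₀, rfl⟩ := exists_countable_subfield hS
    (E := {a, b} ∪ Set.range fun x : Fin (m + 1) × Fin (m + 1) => A.1 x.1 x.2)
    ((Set.toFinite _).union (Set.finite_range _))
  obtain ⟨A, rfl⟩ := exists_specialLinearGroup_map_eq K A fun i j => hE (Or.inr ⟨(i, j), rfl⟩)
  lift a to K using hE (by simp)
  lift b to K using hE (by simp)
  rw [← Subfield.subtype_apply, charpoly_map_isRoot_iff] at ha hb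
  have ha0 : a ≠ 0 := fun h => ha0 (by rw [h]; rfl)
  have hb0 : b ≠ 0 := fun h => hb0 (by rw [h]; rfl)
  simp only [Bir.map_pow_mem]
  obtain ⟨L, _, f, hf⟩ := exists_ringHom_norm_ne_one (x := a / b) fun n hn h =>
    hab n hn (by simpa using congrArg K.subtype h)
  obtain ⟨v, hv, hva⟩ := exists_vecMul_eq_smul ((charpoly_map_isRoot_iff f A a).2 ha)
  obtain ⟨w, hw, hwb⟩ := exists_vecMul_eq_smul ((charpoly_map_isRoot_iff f A b).2 hb)
  have ha1 : f a ≠ 0 := (map_ne_zero f).2 ha0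
  have hb1 : f b ≠ 0 := (map_ne_zero f).2 hb0
  rw [map_div₀, norm_div, Ne, div_eq_one_iff_eq (norm_ne_zero_iff.2 hb1)] at hf
  have hfin : (Bir.map f '' S₀).Finite := hS₀.image _
  rcases lt_or_gt_of_ne hf with hlt | hlt
  · obtain ⟨B, hB⟩ := exists_le_pow_of_eigenvectors _ hfin hw hv hwb hva ha1 hlt
    exact ⟨B, fun n i hi => hB n i ((Bir.map_pow_mem f).2 hi)⟩
  · obtain ⟨B, hB⟩ := exists_le_pow_of_eigenvectors _ hfin hv hw hva hwb hb1 hlt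
    exact ⟨B, fun n i hi => hB n i ((Bir.map_pow_mem f).2 hi)⟩

theorem exists_le_pow_pow (A : Matrix.SpecialLinearGroup (Fin (m + 1)) k)
    (hA : ¬ IsOfFinOrder A) (hu : IsVirtuallyUnipotent A.1) {S : Set (Bir k m)} (hS : S.Finite) :
    ∃ R : ℝ, 1 ≤ R ∧ ∃ D : ℕ, 1 ≤ D ∧
      ∀ n i : ℕ, ofSL A ^ i ∈ S ^ n → (i : ℝ) ≤ R ^ D ^ (n + 1) := by
  obtain ⟨r, hr, hnil⟩ := hu
  -- Infinite order is what guarantees a nontrivial Jordan block.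
  have hne : A ^ r ≠ 1 := fun h => hA (isOfFinOrder_iff_pow_eq_one.2 ⟨r, hr, h⟩)
  obtain ⟨K, hKc, hE, S₀, hS₀, rfl⟩ := exists_countable_subfield hS
    (E := Set.range fun x : Fin (m + 1) × Fin (m + 1) => A.1 x.1 x.2) (Set.finite_range _)
  obtain ⟨A, rfl⟩ := exists_specialLinearGroup_map_eq K A fun i j => hE ⟨(i, j), rfl⟩
  simp only [Bir.map_pow_mem]
  obtain ⟨f⟩ := exists_algHom_of_countable (R := ℚ) (K := K) (L := ℂ)
  rw [coe_map_pow_sub_one, IsNilpotent.map_iff (Matrix.map_injective K.subtype.injective)] at hnil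
  have hB0 : A.1 ^ r - 1 ≠ 0 := fun h => hne (by
    rw [← map_pow]
    have : A ^ r = 1 := Subtype.ext (by simpa [sub_eq_zero] using h)
    rw [this, map_one])
  set A₁ := Matrix.SpecialLinearGroup.map (f : K →+* ℂ) A with hA₁
  have hnil' : IsNilpotent (A₁.1 ^ r - 1) := by
    rw [hA₁, coe_map_pow_sub_one]
    exact hnil.map _
  have hB0' : A₁.1 ^ r - 1 ≠ 0 := by
    rw [hA₁, coe_map_pow_sub_one]
    exact fun h => hB0 (Matrix.map_injective f.injective
      (h.trans (map_zero (f : K →+* ℂ).mapMatrix).symm))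
  obtain ⟨v, w, hv, hwv, hv0⟩ := exists_vecMul_eq_of_isNilpotent hnil' hB0'
  rw [vecMul_sub, vecMul_one] at hwv hv0
  have hcoe : (A₁ ^ r).1 = A₁.1 ^ r := Matrix.SpecialLinearGroup.coe_pow A₁ r
  obtain ⟨R, hR, D, hD, h⟩ := exists_le_pow_pow_of_shift (fun i => Complex.norm_natCast i)
    (A₁ ^ r) (hS₀.image (Bir.map (f : K →+* ℂ))) (v := v) (w := w) hv
    (by rw [hcoe]; exact sub_eq_zero.1 hv0) (by rw [hcoe, ← hwv]; abel)
  -- If `A ^ i` has length `n`, then `(A ^ r) ^ i` has length `n * r`, and `n * r + 1 ≤ r * (n + 1)`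
  -- because `r ≥ 1`.
  refine ⟨R, hR, D ^ r, Nat.one_le_pow _ _ hD, fun n i hi => ?_⟩
  have hi' : ofSL (A₁ ^ r) ^ i ∈ (Bir.map (f : K →+* ℂ) '' S₀) ^ (n * r) := by
    rw [map_pow, ← pow_mul, mul_comm r i, pow_mul _ n r, pow_mul]
    exact Set.pow_mem_pow ((Bir.map_pow_mem (f : K →+* ℂ)).2 hi)
  refine (h _ _ hi').trans (pow_le_pow_right₀ hR ?_)
  rw [← pow_mul]
  exact Nat.pow_le_pow_right hD (by nlinarith)

end Upper

end Cremona

namespace Cremona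

/-! ### Conjugating a nilpotent endomorphism to a multiple of itself -/

section Endomorphism

open LinearMap

/-- A subspace has a projection which preserves a given second subspace. -/
theorem exists_projection_mem {K V : Type*} [Field K] [AddCommGroup V] [Module K V]
    (W N : Submodule K V) :
    ∃ q : V →ₗ[K] W, (∀ w : W, q w = w) ∧ ∀ v ∈ N, (q v : V) ∈ N := by
  obtain ⟨C₁, hd, hs⟩ := IsModularLattice.exists_disjoint_and_sup_eq (inf_le_right : W ⊓ N ≤ N)
  have hC₁ : C₁ ≤ N := le_sup_right.trans hs.le
  have hd' : Disjoint C₁ W := by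
    rw [Submodule.disjoint_def] at hd ⊢
    exact fun x hxC hx => hd x ⟨hx, hC₁ hxC⟩ hxC
  obtain ⟨C, hC, hCW⟩ := hd'.exists_isCompl
  refine ⟨W.projectionOnto C hCW.symm, fun w => Submodule.projectionOnto_apply_left _ w,
    fun v hv => ?_⟩
  rw [← hs] at hv
  obtain ⟨w, hw, c, hc, rfl⟩ := Submodule.mem_sup.1 hv
  rw [map_add, Submodule.projectionOnto_apply_of_mem_right _ (hC hc), add_zero]
  rw [show W.projectionOnto C hCW.symm w = ⟨w, hw.1⟩ from
    Submodule.projectionOnto_apply_left _ ⟨w, hw.1⟩]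
  exact hw.2

/-- A nilpotent endomorphism `Y` is conjugate to `c * Y` for every injective `c` commuting
with `Y`. -/
theorem exists_linearEquiv_comp_eq {K : Type*} [Field K] (n : ℕ) :
    ∀ {V : Type*} [AddCommGroup V] [Module K V] [FiniteDimensional K V] (Y c : Module.End K V),
      Y ^ n = 0 → Commute Y c → Function.Injective c →
      ∃ D : V ≃ₗ[K] V, ∀ v, D (Y v) = c (Y (D v)) := by
  induction n with
  | zero =>
    intro V _ _ _ Y c hY _ _
    have h : ∀ v : V, v = 0 := fun v => by simpa using LinearMap.congr_fun hY v
    exact ⟨LinearEquiv.refl K V, fun v => (h _).trans (h _).symm⟩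
  | succ n ih =>
    intro V _ _ _ Y c hY hc hinj
    have hcomm : ∀ v, Y (c v) = c (Y v) := fun v => LinearMap.congr_fun hc v
    set W := LinearMap.range Y with hW
    have hcW : ∀ w ∈ W, c w ∈ W := by
      rintro _ ⟨v, rfl⟩
      exact ⟨c v, hcomm v⟩
    set YW : Module.End K W := Y.restrict fun v (_ : v ∈ W) => LinearMap.mem_range_self Y v
      with hYW
    set cW : Module.End K W := c.restrict hcW
    have hYWn : YW ^ n = 0 := by
      ext ⟨w, v, rfl⟩
      rw [hYW, Module.End.pow_restrict]
      change (Y ^ n) (Y v) = 0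
      rw [← Module.End.mul_apply, ← pow_succ, hY]
      rfl
    have hcWinj : Function.Injective cW := fun a b h =>
      Subtype.ext (hinj (congrArg Subtype.val h))
    obtain ⟨DW, hDW⟩ := ih YW cW hYWn (LinearMap.ext fun w => Subtype.ext (hcomm w)) hcWinj
    have hsurj : LinearMap.range (cW ∘ₗ Y.rangeRestrict) = ⊤ :=
      LinearMap.range_eq_top.2 ((LinearMap.injective_iff_surjective.1 hcWinj).comp
        Y.surjective_rangeRestrict)
    obtain ⟨s, hs⟩ := (cW ∘ₗ Y.rangeRestrict).exists_rightInverse_of_surjective hsurj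
    obtain ⟨q, hqW, hqK⟩ := exists_projection_mem W (LinearMap.ker Y)
    obtain ⟨e, he⟩ := (LinearMap.ker Y).subtype.exists_leftInverse_of_injective
      (Submodule.ker_subtype _)
    have hs' : ∀ w : W, c (Y (s w)) = w := fun w =>
      congrArg Subtype.val (LinearMap.congr_fun hs w)
    have he' : ∀ v (hv : Y v = 0), (e v : V) = v := fun v hv =>
      congrArg Subtype.val (LinearMap.congr_fun he ⟨v, hv⟩)
    have heY : ∀ v, Y (e v) = 0 := fun v => (e v).2
    -- On `W = range Y` this is the map given by induction. On `ker q`, the section `s` of `c * Y`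
    -- enforces `c (Y (D v)) = D (Y v)`, and the term `e`, which takes values in `ker Y` and so does
    -- not disturb this relation, makes `D` injective.
    let D : V →ₗ[K] V := W.subtype ∘ₗ DW.toLinearMap ∘ₗ q
      + (s ∘ₗ DW.toLinearMap ∘ₗ Y.rangeRestrict + (LinearMap.ker Y).subtype ∘ₗ e) ∘ₗ
        (LinearMap.id - W.subtype ∘ₗ q)
    have hD : ∀ v, D v = DW (q v) + (s (DW (Y.rangeRestrict (v - q v))) + e (v - q v)) :=
      fun _ => rfl
    have hDWY : ∀ w : W, c (Y (DW w)) = DW (Y.rangeRestrict (w : V)) := fun w =>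
      congrArg Subtype.val (hDW w).symm
    have hDc : ∀ v, c (Y (D v)) = DW (Y.rangeRestrict v) := fun v => by
      rw [hD, map_add, map_add, map_add, map_add, heY, map_zero, add_zero, hs', hDWY,
        ← Submodule.coe_add, ← map_add, ← map_add, add_sub_cancel]
    have hDY : ∀ v, D (Y v) = c (Y (D v)) := fun v => by
      have h1 : q (Y v) = Y.rangeRestrict v := hqW (Y.rangeRestrict v)
      have h2 : Y v - q (Y v) = 0 := by
        rw [h1]
        exact sub_self _
      rw [hDc, hD, h2, map_zero, map_zero, map_zero, map_zero, h1]
      simp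
    have hDinj : Function.Injective D := by
      rw [← LinearMap.ker_eq_bot, LinearMap.ker_eq_bot']
      intro v hv
      have h1 : Y v = 0 := by
        have h := hDc v
        rw [hv, map_zero, map_zero] at h
        have h2 := DW.map_eq_zero_iff.1 (Subtype.ext h.symm)
        exact congrArg Subtype.val h2
      -- This needs a projection `q` that preserves `ker Y`.
      have h2 : Y (v - q v) = 0 := by
        rw [map_sub, h1, show Y (q v) = 0 from hqK v h1, sub_zero]
      have h3 : Y.rangeRestrict (v - q v) = 0 := Subtype.ext h2
      rw [hD, h3, map_zero, map_zero, zero_add, he' _ h2] at hv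
      have h4 : q (v - q v) = 0 := by rw [map_sub, hqW, sub_self]
      have h5 : v - q v = -(DW (q v) : V) := eq_neg_of_add_eq_zero_right hv
      have h6 : q v = v := by
        rw [h5, map_neg, hqW, neg_eq_zero] at h4
        rw [h4] at h5
        rw [Submodule.coe_zero, neg_zero] at h5
        exact (sub_eq_zero.1 h5).symm
      rw [h6, sub_self, add_zero] at hv
      have h7 := DW.map_eq_zero_iff.1 (Subtype.ext hv)
      rw [← h6, h7]
      rfl
    exact ⟨LinearEquiv.ofInjectiveEndo D hDinj, hDY⟩

/-- A semisimple endomorphism over an algebraically closed field has a basis of eigenvectors. -/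
theorem exists_basis_eigenvectors {K V : Type*} [Field K] [IsAlgClosed K] [AddCommGroup V]
    [Module K V] [FiniteDimensional K V] {f : Module.End K V} (hf : f.IsSemisimple) :
    ∃ (b : Module.Basis (Fin (Module.finrank K V)) K V) (t : Fin (Module.finrank K V) → K),
      ∀ i, f (b i) = t i • b i := by
  have hspan : ⊤ ≤ Submodule.span K {v : V | ∃ a : K, f v = a • v} := by
    rw [← hf.iSup_eigenspace_eq_top]
    exact iSup_le fun a v hv => Submodule.subset_span ⟨a, Module.End.mem_eigenspace_iff.1 hv⟩
  let b := Module.Basis.ofSpan hspan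
  have hb : ∀ i, ∃ a : K, f (b i) = a • b i := fun i =>
    Module.Basis.ofSpan_subset hspan ⟨i, rfl⟩
  have := FiniteDimensional.fintypeBasisIndex b
  choose t ht using hb
  let e := b.indexEquiv (Module.finBasis K V)
  exact ⟨b.reindex e, t ∘ e.symm, fun i => by simp [ht]⟩

end Endomorphism

/-! ### Unipotent matrices and the Jordan decomposition -/

section MatrixGroup

open Matrix

variable {k : Type*} [Field k] {n : ℕ}

/-- Since `U ^ 2 - 1 = (U + 1) * (U - 1)`, it suffices to conjugate the nilpotent `U - 1` to its
product with `U + 1`. In characteristic zero `U + 1` is `2` plus a nilpotent, hence invertible. -/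
theorem exists_conj_eq_sq [CharZero k] (U : GL (Fin n) k) (hU : IsNilpotent (U.1 - 1)) :
    ∃ E : GL (Fin n) k, E * U * E⁻¹ = U ^ 2 := by
  obtain ⟨r, hr⟩ := hU
  have hunit : IsUnit (U.1 + 1) := by
    have h : U.1 + 1 = algebraMap k (Matrix (Fin n) (Fin n) k) 2 + (U.1 - 1) := by
      rw [map_ofNat, ← one_add_one_eq_two]
      abel
    rw [h]
    exact IsNilpotent.isUnit_add_left_of_commute ⟨r, hr⟩
      ((IsUnit.mk0 (2 : k) two_ne_zero).map _) (Algebra.commute_algebraMap_right _ _)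
  obtain ⟨D, hD⟩ := exists_linearEquiv_comp_eq r (toLin' (U.1 - 1)) (toLin' (U.1 + 1))
    (by rw [← toLin'_pow, hr, map_zero])
    (by
      have h : Commute (U.1 - 1) (U.1 + 1) := by
        rw [commute_iff_eq]
        noncomm_ring
      exact h.map toLinAlgEquiv')
    (by
      have := (hunit.map toLinAlgEquiv')
      exact ((Module.End.isUnit_iff _).1 this).1)
  have hmat : LinearMap.toMatrix' D.toLinearMap * (U.1 - 1)
      = (U.1 + 1) * (U.1 - 1) * LinearMap.toMatrix' D.toLinearMap := by
    apply toLin'.injective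
    rw [toLin'_mul, toLin'_mul, toLin'_mul, toLin'_toMatrix']
    exact LinearMap.ext hD
  let E : GL (Fin n) k := ⟨LinearMap.toMatrix' D.toLinearMap,
    LinearMap.toMatrix' D.symm.toLinearMap,
    by rw [← LinearMap.toMatrix'_comp, LinearEquiv.comp_symm, LinearMap.toMatrix'_id],
    by rw [← LinearMap.toMatrix'_comp, LinearEquiv.symm_comp, LinearMap.toMatrix'_id]⟩
  refine ⟨E, mul_inv_eq_iff_eq_mul.2 (Units.ext ?_)⟩
  change LinearMap.toMatrix' D.toLinearMap * U.1 = U.1 ^ 2 * LinearMap.toMatrix' D.toLinearMap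
  generalize LinearMap.toMatrix' D.toLinearMap = M at hmat
  have h : (U.1 + 1) * (U.1 - 1) = U.1 ^ 2 - 1 := by noncomm_ring
  rw [h, mul_sub, sub_mul, mul_one, one_mul] at hmat
  exact sub_left_injective hmat

/-- The multiplicative Jordan decomposition of an invertible matrix. -/
theorem exists_diagonal_mul_unipotent [CharZero k] [IsAlgClosed k] (B : GL (Fin n) k) :
    ∃ (g U D : GL (Fin n) k) (t : Fin n → kˣ), D.1 = diagonal (fun i => (t i : k)) ∧
      IsNilpotent (U.1 - 1) ∧ B = g * D * g⁻¹ * U ∧ Commute (g * D * g⁻¹) U := by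
  obtain ⟨N, hN, s, hs, hnil, hss, hf⟩ :=
    Module.End.exists_isNilpotent_isSemisimple (f := toLin' B.1)
  have hNs : Commute N s := by
    have := Algebra.commute_of_mem_adjoin_singleton_of_commute hN
      (Algebra.commute_of_mem_adjoin_self hs).symm
    exact this.symm
  have hBu : IsUnit (toLin' B.1 : Module.End k (Fin n → k)) := B.isUnit.map toLinAlgEquiv'
  have hsu : IsUnit s := by
    have h : s = toLin' B.1 + -N := by rw [hf]; abel
    rw [h]
    refine hnil.neg.isUnit_add_left_of_commute hBu ?_
    rw [hf]
    exact ((Commute.refl N).add_right hNs).neg_left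
  obtain ⟨b, t, hb⟩ : ∃ (b : Module.Basis (Fin n) k (Fin n → k)) (t : Fin n → k),
      ∀ i, s (b i) = t i • b i := by
    obtain ⟨b, t, hb⟩ := exists_basis_eigenvectors hss
    have e := finCongr (Module.finrank_fin_fun (R := k) (n := n))
    exact ⟨b.reindex e, t ∘ e.symm, fun i => by simp [hb]⟩
  have ht : ∀ i, t i ≠ 0 := fun i h0 => by
    have h1 := hb i
    rw [h0, zero_smul] at h1
    exact b.ne_zero i (((Module.End.isUnit_iff _).1 hsu).1 (h1.trans (map_zero s).symm))
  let D : GL (Fin n) k := ⟨diagonal t, diagonal fun i => (t i)⁻¹,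
    by simp [diagonal_mul_diagonal, ht], by simp [diagonal_mul_diagonal, ht]⟩
  let g : GL (Fin n) k := ⟨(Pi.basisFun k (Fin n)).toMatrix b, b.toMatrix (Pi.basisFun k (Fin n)),
    Module.Basis.toMatrix_mul_toMatrix_flip _ _, Module.Basis.toMatrix_mul_toMatrix_flip _ _⟩
  set M : Matrix (Fin n) (Fin n) k := LinearMap.toMatrix' s with hM
  have hMg : M * g.1 = g.1 * D.1 := by
    ext i j
    change (M * (Pi.basisFun k (Fin n)).toMatrix b) i j
      = ((Pi.basisFun k (Fin n)).toMatrix b * diagonal t) i j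
    have h1 := congrFun (hb j) i
    rw [← toLin'_toMatrix' s, ← hM, toLin'_apply] at h1
    rw [mul_diagonal, mul_apply]
    simpa [mulVec, dotProduct, Module.Basis.toMatrix_apply, mul_comm] using h1
  have hMD : (g * D * g⁻¹).1 = M := by
    rw [Units.val_mul, Units.val_mul, ← hMg, mul_assoc, Units.mul_inv, mul_one]
  have hMB : Commute M B.1 := by
    have h1 : Commute s (toLin' B.1) := by
      rw [hf]
      exact hNs.symm.add_right (Commute.refl s)
    have h2 : Commute (LinearMap.toMatrix' s) (LinearMap.toMatrix' (toLin' B.1)) :=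
      h1.map (LinearMap.toMatrixAlgEquiv' (R := k) (n := Fin n))
    rwa [LinearMap.toMatrix'_toLin'] at h2
  have hcomm : Commute (g * D * g⁻¹) B := Units.ext (by
    rw [Units.val_mul, Units.val_mul _ (g * D * g⁻¹), hMD]
    exact hMB)
  refine ⟨g, (g * D * g⁻¹)⁻¹ * B, D, fun i => Units.mk0 (t i) (ht i), rfl, ?_,
    (mul_inv_cancel_left _ _).symm, (Commute.refl _).inv_right.mul_right hcomm⟩
  have hNM : B.1 - M = LinearMap.toMatrix' N := by
    apply toLin'.injective
    rw [map_sub, hf, hM, toLin'_toMatrix', toLin'_toMatrix', add_sub_cancel_right]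
  -- The unipotent part minus `1` is the additive nilpotent part times a commuting unit.
  have h1 : ((g * D * g⁻¹)⁻¹ * B).1 - 1 = ((g * D * g⁻¹)⁻¹).1 * (B.1 - M) := by
    rw [Units.val_mul, mul_sub, ← hMD, Units.inv_mul]
  rw [h1]
  refine Commute.isNilpotent_mul_left ?_ ?_
  · have h2 : Commute ((g * D * g⁻¹).1) (B.1 - M) := by
      rw [hMD]
      exact hMB.sub_right (Commute.refl M)
    exact h2.units_inv_left
  · rw [hNM]
    exact hnil.map (LinearMap.toMatrixAlgEquiv' (R := k) (n := Fin n))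

end MatrixGroup

end Cremona

/-! ### Sequences of linear word length -/

namespace Distortion

variable {G : Type*} [Group G]

/-- The word length of `g n`, with respect to some finite set, grows at most linearly. -/
def HasLinearLength (g : ℕ → G) : Prop :=
  ∃ S : Set G, S.Finite ∧ 1 ∈ S ∧ ∃ C : ℕ, ∀ n, g n ∈ S ^ (C * (n + 1))

theorem HasLinearLength.mul {g h : ℕ → G} (hg : HasLinearLength g) (hh : HasLinearLength h) :
    HasLinearLength fun n => g n * h n := by
  obtain ⟨S, hS, h1, C, hC⟩ := hg
  obtain ⟨T, hT, -, D, hD⟩ := hh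
  refine ⟨S ∪ T, hS.union hT, Or.inl h1, C + D, fun n => ?_⟩
  rw [add_mul, pow_add]
  exact Set.mul_mem_mul (Set.pow_subset_pow_left Set.subset_union_left (hC n))
    (Set.pow_subset_pow_left Set.subset_union_right (hD n))

theorem hasLinearLength_pow (g : G) : HasLinearLength fun n => g ^ n := by
  refine ⟨{1, g}, Set.toFinite _, Or.inl rfl, 1, fun n => ?_⟩
  exact Set.pow_subset_pow_right (s := {1, g}) (by simp) (by omega : n ≤ 1 * (n + 1))
    (Set.pow_mem_pow (by simp))

theorem hasLinearLength_const (g : G) : HasLinearLength fun _ => g := by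
  refine ⟨{1, g}, Set.toFinite _, Or.inl rfl, 1, fun n => ?_⟩
  exact Set.pow_subset_pow_right (s := {1, g}) (by simp) (by omega : 1 ≤ 1 * (n + 1)) (by simp)

theorem HasLinearLength.conj {g : ℕ → G} (hg : HasLinearLength g) (x : G) :
    HasLinearLength fun n => x * g n * x⁻¹ :=
  ((hasLinearLength_const x).mul hg).mul (hasLinearLength_const x⁻¹)

/-- Horner's scheme in base two: doubling the exponent costs a conjugation by `x` and each digit at
most one `u`, so three letters per binary digit. -/
theorem pow_mem_of_conj_eq_sq {x u : G} (h : x * u * x⁻¹ = u ^ 2) {S : Set G} (h1 : 1 ∈ S)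
    (hu : u ∈ S) (hx : x ∈ S) (hx' : x⁻¹ ∈ S) (n : ℕ) : ∀ i < 2 ^ n, u ^ i ∈ S ^ (3 * n) := by
  induction n with
  | zero =>
    intro i hi
    rw [show i = 0 by omega]
    simp
  | succ n ih =>
    intro i hi
    have h2 : u ^ i = x * u ^ (i / 2) * (x⁻¹ * u ^ (i % 2)) := by
      conv_lhs => rw [← Nat.div_add_mod i 2, pow_add, pow_mul, ← h, conj_pow]
      rw [mul_assoc]
    have h3 : u ^ (i % 2) ∈ S := by
      rcases Nat.mod_two_eq_zero_or_one i with h0 | h0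
      · rwa [h0, pow_zero]
      · rwa [h0, pow_one]
    rw [h2, show 3 * (n + 1) = 1 + 3 * n + (1 + 1) by ring, pow_add, pow_add, pow_add, pow_one]
    exact Set.mul_mem_mul (Set.mul_mem_mul hx (ih _ (by omega))) (Set.mul_mem_mul hx' h3)

/-- If `x` conjugates `u` to its square, then powers of `u` are logarithmically short. -/
theorem hasLinearLength_of_conj_eq_sq {x u : G} (h : x * u * x⁻¹ = u ^ 2) {v : ℕ → ℕ}
    (hv : ∀ n, v n < 4 ^ (n + 1)) : HasLinearLength fun n => u ^ v n := by
  -- An exponent below `4 ^ (n + 1)` has `2 * (n + 1)` binary digits, at three letters each.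
  refine ⟨{1, u, x, x⁻¹}, Set.toFinite _, by simp, 6, fun n => ?_⟩
  have := pow_mem_of_conj_eq_sq h (S := {1, u, x, x⁻¹}) (by simp) (by simp) (by simp) (by simp)
    (2 * (n + 1)) (v n) (by rw [pow_mul]; exact hv n)
  rwa [← mul_assoc] at this

/-- The traces of the powers of a matrix in `SL₂(ℤ)` of trace `3`. -/
def traceSeq : ℕ → ℕ
  | 0 => 2
  | 1 => 3
  | n + 2 => 3 * traceSeq (n + 1) - traceSeq n

/-- Ensures that the subtraction in the recursion is never truncated. -/
theorem traceSeq_mono (n : ℕ) : traceSeq n ≤ traceSeq (n + 1) := by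
  induction n with
  | zero => decide
  | succ n ih =>
    rw [traceSeq]
    omega

theorem traceSeq_add (n : ℕ) : traceSeq (n + 2) + traceSeq n = 3 * traceSeq (n + 1) := by
  have := traceSeq_mono n
  rw [traceSeq]
  omega

theorem two_pow_le_traceSeq (n : ℕ) : 2 ^ n ≤ traceSeq n := by
  induction n using Nat.twoStepInduction with
  | zero => decide
  | one => decide
  | more n _ ih =>
    have h1 := traceSeq_mono n
    have h2 := traceSeq_add n
    rw [pow_succ]
    omega

theorem traceSeq_lt (n : ℕ) : traceSeq n < 4 ^ (n + 1) := by
  induction n using Nat.twoStepInduction with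
  | zero => decide
  | one => decide
  | more n _ ih =>
    have h2 := traceSeq_add n
    calc traceSeq (n + 2) ≤ 4 * traceSeq (n + 1) := by omega
      _ < 4 * 4 ^ (n + 1 + 1) := (Nat.mul_lt_mul_left (by norm_num)).2 ih
      _ = 4 ^ (n + 2 + 1) := (pow_succ' _ _).symm

/-- Written additively, `hφ` says `φ² - 3φ + 1 = 0`, so the powers of `φ` and of `φ⁻¹` satisfy the
recursion of `traceSeq`. Their sum starts with the scalars `2` and `3`, so it remains scalar. -/
theorem mulAut_pow_mul_eq {T : Type*} [CommGroup T] (φ : MulAut T)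
    (hφ : ∀ t, φ (φ t) * t = φ t ^ 3) (t : T) (n : ℕ) :
    (φ ^ n) t * (φ⁻¹ ^ n) t = t ^ traceSeq n := by
  have h1 : ∀ n, (φ ^ (n + 2)) t * (φ ^ n) t = (φ ^ (n + 1)) t ^ 3 := fun n => by
    rw [pow_succ' φ (n + 1), pow_succ' φ n]
    exact hφ _
  have h2 : ∀ n, (φ⁻¹ ^ (n + 2)) t * (φ⁻¹ ^ n) t = (φ⁻¹ ^ (n + 1)) t ^ 3 := fun n => by
    have h := hφ ((φ⁻¹ ^ (n + 2)) t)
    have h3 : φ ((φ⁻¹ ^ (n + 2)) t) = (φ⁻¹ ^ (n + 1)) t := by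
      rw [pow_succ' φ⁻¹ (n + 1)]
      exact MulEquiv.apply_symm_apply φ _
    have h4 : φ ((φ⁻¹ ^ (n + 1)) t) = (φ⁻¹ ^ n) t := by
      rw [pow_succ' φ⁻¹ n]
      exact MulEquiv.apply_symm_apply φ _
    rwa [h3, h4, mul_comm] at h
  induction n using Nat.twoStepInduction with
  | zero => simp [traceSeq, pow_two]
  | one =>
    have h := hφ (φ⁻¹ t)
    have h3 : φ (φ⁻¹ t) = t := MulEquiv.apply_symm_apply φ t
    rw [h3] at h
    simpa [traceSeq] using h
  | more n ih1 ih2 =>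
    have h : ((φ ^ (n + 2)) t * (φ⁻¹ ^ (n + 2)) t) * ((φ ^ n) t * (φ⁻¹ ^ n) t)
        = ((φ ^ (n + 1)) t * (φ⁻¹ ^ (n + 1)) t) ^ 3 := by
      rw [mul_pow, ← h1, ← h2, mul_mul_mul_comm]
    rw [ih1, ih2, ← pow_mul, mul_comm _ 3, ← traceSeq_add, pow_add t] at h
    exact mul_right_cancel h

/-- Exponential distortion in a group which is normalized by an automorphism of trace `3`. -/
theorem hasLinearLength_of_mulAut {T : Type*} [CommGroup T] (τ : T →* G) (φ : MulAut T)
    (hφ : ∀ t, φ (φ t) * t = φ t ^ 3) (x : G) (hx : ∀ t, x * τ t * x⁻¹ = τ (φ t)) (t : T) :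
    HasLinearLength fun n => τ t ^ traceSeq n := by
  have h1 : ∀ n t, x ^ n * τ t * x⁻¹ ^ n = τ ((φ ^ n) t) := by
    intro n
    induction n with
    | zero => simp
    | succ n ih =>
      intro t
      rw [pow_succ x, pow_succ' x⁻¹, pow_succ φ, MulAut.mul_apply, ← ih, ← hx]
      group
  have h2 : ∀ n t, x⁻¹ ^ n * τ t * x ^ n = τ ((φ⁻¹ ^ n) t) := by
    intro n t
    have h3 : (φ ^ n) ((φ⁻¹ ^ n) t) = t := by
      rw [← MulAut.mul_apply, inv_pow, mul_inv_cancel, MulAut.one_apply]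
    conv_lhs => rw [← h3, ← h1]
    group
  have h3 : (fun n => τ t ^ traceSeq n)
      = fun n => (x ^ n * τ t * x⁻¹ ^ n) * (x⁻¹ ^ n * τ t * x ^ n) := by
    funext n
    rw [h1, h2, ← map_mul, mulAut_pow_mul_eq φ hφ, map_pow]
  rw [h3]
  exact (((hasLinearLength_pow x).mul (hasLinearLength_const _)).mul (hasLinearLength_pow x⁻¹)).mul
    (((hasLinearLength_pow x⁻¹).mul (hasLinearLength_const _)).mul (hasLinearLength_pow x))

theorem HasLinearLength.typeAtLeast {c : G} {v : ℕ → ℕ} (h : HasLinearLength fun n => c ^ v n)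
    {f : ℝ≥0 → ℝ≥0∞} (hf : ∀ (x : ℝ≥0) (n : ℕ), 2 * x + 1 ≤ n → f x ≤ v n) :
    TypeAtLeast c f := by
  obtain ⟨S₀, hS₀, h1, C, hC⟩ := h
  set S := S₀ ∪ S₀⁻¹ ∪ {c, c⁻¹} with hS
  have hsub : S₀ ⊆ S := Set.subset_union_left.trans Set.subset_union_left
  have h1S : 1 ∈ S := hsub h1
  refine ⟨Subgroup.closure S, Subgroup.subset_closure (Or.inr (Or.inl rfl)), S,
    ⟨(hS₀.union hS₀.inv).union (Set.toFinite _), ?_, h1S, rfl⟩, ?_⟩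
  · rw [hS, Set.union_inv, Set.union_inv, inv_inv, Set.union_comm S₀⁻¹ S₀, Set.inv_insert,
      Set.inv_singleton, inv_inv, Set.pair_comm]
  -- For `x < 1`, `n = 3` is admissible and `v 3` bounds `f x`. For `x ≥ 1`, `n = ⌈2 * x⌉₊ + 1`
  -- satisfies `n + 1 ≤ 2 * x + 3 ≤ 5 * x`.
  refine ⟨1, 5 * C + 1, v 3 + 1, one_pos, by positivity, by positivity, fun x => ?_⟩
  rcases lt_or_ge x 1 with hx | hx
  · refine (hf x 3 ?_).trans (le_add_of_nonneg_of_le zero_le ?_)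
    · push_cast
      linarith
    · push_cast
      exact le_self_add
  · refine le_trans ?_ le_self_add
    set n := ⌈2 * x⌉₊ + 1 with hn
    have hn1 : 2 * x + 1 ≤ n := by
      rw [hn]
      push_cast
      gcongr
      exact Nat.le_ceil _
    have hn2 : C * (n + 1) ≤ ⌊(5 * C + 1) * x⌋₊ := by
      refine Nat.le_floor ?_
      have h3 : (⌈2 * x⌉₊ : ℝ≥0) ≤ 2 * x + 1 := (Nat.ceil_lt_add_one zero_le).le
      have h4 : (n : ℝ≥0) + 1 ≤ 5 * x := by
        rw [hn]
        push_cast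
        have h5 : (3 : ℝ≥0) ≤ 3 * x := le_mul_of_one_le_right zero_le hx
        calc (⌈2 * x⌉₊ : ℝ≥0) + 1 + 1 ≤ 2 * x + 1 + 1 + 1 := by gcongr
          _ = 2 * x + 3 := by ring
          _ ≤ 2 * x + 3 * x := by gcongr
          _ = 5 * x := by ring
      push_cast
      calc (C : ℝ≥0) * (n + 1) ≤ C * (5 * x) := by gcongr
        _ = (5 * C) * x := by ring
        _ ≤ (5 * C + 1) * x := by gcongr; exact le_self_add
    rw [ENNReal.coe_one, one_mul]
    refine (hf x n hn1).trans ?_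
    exact le_iSup₂_of_le (v n) (Set.pow_subset_pow_right h1S hn2
      (Set.pow_subset_pow_left hsub (hC n))) le_rfl

/-- The spare factor `2` compensates `log 2 < 1` when a second exponential in base two is compared
with `exp`. -/
theorem two_mul_exp_le_two_pow {x : ℝ≥0} {n : ℕ} (h : 2 * x + 1 ≤ n) :
    2 * Real.exp x ≤ 2 ^ n := by
  have h1 : (2 * x + 1 : ℝ) ≤ n := by exact_mod_cast h
  have h2 := Real.log_two_gt_d9
  have hx : (0 : ℝ) ≤ x := x.2
  have h3 : (2 : ℝ) ^ n = Real.exp (n * Real.log 2) := by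
    rw [Real.exp_nat_mul, Real.exp_log two_pos]
  rw [h3, ← Real.exp_log (two_pos : (0 : ℝ) < 2), ← Real.exp_add, Real.exp_log two_pos]
  refine Real.exp_le_exp.2 ?_
  nlinarith

theorem HasLinearLength.typeAtLeast_expFun {c : G} {v : ℕ → ℕ}
    (h : HasLinearLength fun n => c ^ v n) (hv : ∀ n, 2 ^ n ≤ v n) : TypeAtLeast c expFun := by
  refine h.typeAtLeast fun x n hxn => ?_
  rw [expFun, ← ENNReal.ofReal_natCast]
  refine ENNReal.ofReal_le_ofReal ?_
  have h1 := two_mul_exp_le_two_pow hxn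
  have h2 : (2 : ℝ) ^ n ≤ v n := by exact_mod_cast hv n
  linarith [Real.exp_pos x]

theorem HasLinearLength.typeAtLeast_expExpFun {c : G} {v : ℕ → ℕ}
    (h : HasLinearLength fun n => c ^ v n) (hv : ∀ n, 2 ^ 2 ^ n ≤ v n) :
    TypeAtLeast c expExpFun := by
  refine h.typeAtLeast fun x n hxn => ?_
  rw [expExpFun, ← ENNReal.ofReal_natCast]
  refine ENNReal.ofReal_le_ofReal ?_
  have h1 := two_mul_exp_le_two_pow hxn
  have h2 : (2 : ℝ) ^ 2 ^ n ≤ v n := by exact_mod_cast hv n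
  refine le_trans ?_ h2
  rw [← Real.exp_log (show (0 : ℝ) < 2 ^ 2 ^ n by positivity), Real.log_pow]
  refine Real.exp_le_exp.2 ?_
  push_cast
  nlinarith [Real.log_two_gt_d9, Real.exp_pos x]

end Distortion

namespace Cremona

open MvPolynomial Distortion

/-! ### Monomial maps, tori and the lower bounds -/

section Lower

variable {k : Type*} [Field k] {m : ℕ}

/-- The homomorphism `GL_{m+1}(k) → Bir(ℙ^m_k)`. -/
noncomputable def ofGL : Matrix.GeneralLinearGroup (Fin (m + 1)) k →* Bir k m where
  toFun A := Bir.mk (linearTuple A.1) (isBirational_linearTuple A.mul_inv A.inv_mul)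
  map_one' := (Bir.mk_eq_mk _ _).2 (by
    rw [Units.val_one, linearTuple_one]
    exact SameMap.refl _)
  map_mul' A B := (Bir.mk_eq_mk _ ((isBirational_linearTuple A.mul_inv A.inv_mul).comp
      (isBirational_linearTuple B.mul_inv B.inv_mul))).2 (by
    rw [comp_linearTuple, Units.val_mul]
    exact SameMap.refl _)

theorem ofGL_toGL (A : Matrix.SpecialLinearGroup (Fin (m + 1)) k) :
    ofGL (Matrix.SpecialLinearGroup.toGL A) = ofSL A := rfl

/-- Diagonal matrices in the Cremona group. -/
noncomputable def torus : (Fin (m + 1) → kˣ) →* Bir k m :=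
  ofGL.comp ((Units.map (Matrix.diagonalRingHom (Fin (m + 1)) k).toMonoidHom).comp
    MulEquiv.piUnits.symm.toMonoidHom)

theorem linearTuple_diagonal (d : Fin (m + 1) → k) :
    linearTuple (Matrix.diagonal d) = fun i => C (d i) * X i := by
  funext i
  rw [linearTuple, Finset.sum_eq_single i (fun j _ hj => by simp [Matrix.diagonal_apply_ne _ hj.symm])
    (fun h => absurd (Finset.mem_univ i) h), Matrix.diagonal_apply_eq]

theorem torus_eq (t : Fin (m + 1) → kˣ) :
    ∃ h, torus t = Bir.mk (fun i => C (t i : k) * X i) h := by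
  have h : linearTuple (Matrix.diagonal fun i => (t i : k)) = fun i => C (t i : k) * X i :=
    linearTuple_diagonal _
  rw [← h]
  exact ⟨_, rfl⟩

variable (k) in
/-- In affine coordinates with `x_o = 1`, the monomial map `(x_a, x_b) ↦ (x_a x_b, x_a)`. -/
noncomputable def fibTuple (o a b : Fin (m + 1)) : Tuple k m := fun c =>
  if c = a then X a * X b else if c = b then X o * X a else X o * X c

variable (k) in
/-- The inverse of `fibTuple`. -/
noncomputable def fibInvTuple (o a b : Fin (m + 1)) : Tuple k m := fun c =>
  if c = a then X b * X b else if c = b then X o * X a else X b * X c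

theorem isBirational_fibTuple {o a b : Fin (m + 1)} (hoa : o ≠ a) (hob : o ≠ b) (hab : a ≠ b) :
    IsBirational (fibTuple k o a b) := by
  have hX : ∀ i j : Fin (m + 1), (X i * X j : MvPolynomial (Fin (m + 1)) k).IsHomogeneous 2 :=
    fun i j => (isHomogeneous_X k i).mul (isHomogeneous_X k j)
  have hX0 : ∀ i : Fin (m + 1), (X i : MvPolynomial (Fin (m + 1)) k) ≠ 0 := fun i => X_ne_zero i
  have hF : IsRational (fibTuple k o a b) := by
    refine ⟨fun h => ?_, 2, fun i => ?_⟩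
    · have := congrFun h a
      simp [fibTuple, hX0] at this
    · unfold fibTuple
      split_ifs <;> exact hX _ _
  have hG : IsRational (fibInvTuple k o a b) := by
    refine ⟨fun h => ?_, 2, fun i => ?_⟩
    · have := congrFun h a
      simp [fibInvTuple, hX0] at this
    · unfold fibInvTuple
      split_ifs <;> exact hX _ _
  have hFG : ∀ i, comp (fibTuple k o a b) (fibInvTuple k o a b) i = X o * X b ^ 2 * X i := by
    intro i
    by_cases hia : i = a
    · subst hia
      simp [comp, fibTuple, fibInvTuple, hab.symm]
      ring
    by_cases hib : i = b
    · subst hib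
      simp [comp, fibTuple, fibInvTuple, hia, hoa, hob]
      ring
    simp [comp, fibTuple, fibInvTuple, hia, hib, hoa, hob]
    ring
  have hGF : ∀ i, comp (fibInvTuple k o a b) (fibTuple k o a b) i = X o ^ 2 * X a * X i := by
    intro i
    by_cases hia : i = a
    · subst hia
      simp [comp, fibTuple, fibInvTuple, hab.symm]
      ring
    by_cases hib : i = b
    · subst hib
      simp [comp, fibTuple, fibInvTuple, hia, hoa, hob]
      ring
    simp [comp, fibTuple, fibInvTuple, hia, hib, hab.symm]
    ring
  have key : ∀ {F G : Tuple k m} {P : MvPolynomial (Fin (m + 1)) k}, P ≠ 0 →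
      (∀ i, comp F G i = P * X i) → IsLeftInverse F G := by
    intro F G P hP h
    refine ⟨fun h0 => ?_, fun i j => ?_⟩
    · have := congrFun h0 0
      rw [h] at this
      exact mul_ne_zero hP (hX0 0) this
    · rw [h, h]
      ring
  exact ⟨hF, _, hG, key (mul_ne_zero (hX0 o) (pow_ne_zero _ (hX0 b))) hFG,
    key (mul_ne_zero (pow_ne_zero _ (hX0 o)) (hX0 a)) hGF⟩

/-- The automorphism `(s, r) ↦ (s r, s)`. -/
def fibEquiv (T : Type*) [CommGroup T] : MulAut (T × T) where
  toFun t := (t.1 * t.2, t.1)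
  invFun t := (t.2, t.1 * t.2⁻¹)
  left_inv t := by ext <;> simp
  right_inv t := by ext <;> simp
  map_mul' s t := by
    ext
    · exact mul_mul_mul_comm _ _ _ _
    · rfl

/-- Cayley–Hamilton for the square of the Fibonacci matrix. The matrix itself has determinant `-1`;
the square has determinant `1` and trace `3`. -/
theorem fibEquiv_relation {T : Type*} [CommGroup T] (t : T × T) :
    (fibEquiv T ^ 2) ((fibEquiv T ^ 2) t) * t = (fibEquiv T ^ 2) t ^ 3 := by
  have h : ∀ s : T × T, (fibEquiv T ^ 2) s = (s.1 * s.2 * s.1, s.1 * s.2) := fun _ => rfl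
  obtain ⟨s, r⟩ := t
  rw [h, h]
  ext
  · simp only [Prod.mk_mul_mk, pow_succ, pow_zero, one_mul]
    ac_rfl
  · simp only [Prod.mk_mul_mk, pow_succ, pow_zero, one_mul]
    ac_rfl

/-- The two-dimensional torus acting on the coordinates `x_a` and `x_b`. -/
noncomputable def torusPair (a b : Fin (m + 1)) : kˣ × kˣ →* Bir k m :=
  torus.comp ((MonoidHom.mulSingle (fun _ => kˣ) a).comp (MonoidHom.fst _ _) *
    (MonoidHom.mulSingle (fun _ => kˣ) b).comp (MonoidHom.snd _ _))

theorem torusPair_apply (a b : Fin (m + 1)) (t : kˣ × kˣ) :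
    (torusPair a b t : Bir k m) = torus (Pi.mulSingle a t.1 * Pi.mulSingle b t.2) := rfl

theorem torusPair_eq {a b : Fin (m + 1)} (hab : a ≠ b) (t : kˣ × kˣ) :
    ∃ h, torusPair a b t = Bir.mk (fun i => C ((if i = a then t.1 else if i = b then t.2 else 1 : kˣ)
      : k) * X i) h := by
  have h2 : (Pi.mulSingle a t.1 * Pi.mulSingle b t.2 : Fin (m + 1) → kˣ)
      = fun i => if i = a then t.1 else if i = b then t.2 else 1 := by
    funext i
    by_cases hia : i = a
    · subst hia
      simp [hab]
    · simp [Pi.mulSingle_apply, hia]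
  rw [torusPair_apply, h2]
  exact torus_eq _

/-- A monomial map normalizes the torus and acts on it through its matrix of exponents. -/
theorem fib_mul_torusPair {o a b : Fin (m + 1)} (hoa : o ≠ a) (hob : o ≠ b) (hab : a ≠ b)
    (t : kˣ × kˣ) :
    Bir.mk _ (isBirational_fibTuple hoa hob hab) * torusPair a b t
      * (Bir.mk _ (isBirational_fibTuple hoa hob hab))⁻¹ = torusPair a b (fibEquiv kˣ t) := by
  rw [mul_inv_eq_iff_eq_mul]
  obtain ⟨h1, e1⟩ := torusPair_eq hab t
  obtain ⟨h2, e2⟩ := torusPair_eq hab (fibEquiv kˣ t)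
  rw [e1, e2, Bir.mk_mul_mk, Bir.mk_mul_mk, Bir.mk_eq_mk]
  have : ∀ {F G : Tuple k m}, F = G → SameMap F G := fun h => h ▸ SameMap.refl _
  refine this (funext fun i => ?_)
  by_cases hia : i = a
  · subst hia
    simp [comp, fibTuple, hab.symm, fibEquiv]
    ring
  by_cases hib : i = b
  · subst hib
    simp [comp, fibTuple, hia, hoa, hob, fibEquiv]
    ring
  simp [comp, fibTuple, hia, hib, hoa, hob]

theorem hasLinearLength_torusPair {o a b : Fin (m + 1)} (hoa : o ≠ a) (hob : o ≠ b) (hab : a ≠ b)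
    (t : kˣ × kˣ) : HasLinearLength fun n => torusPair a b t ^ traceSeq n := by
  refine hasLinearLength_of_mulAut (torusPair a b) (fibEquiv kˣ ^ 2) fibEquiv_relation
    (Bir.mk _ (isBirational_fibTuple hoa hob hab) ^ 2) (fun s => ?_) t
  rw [pow_two (fibEquiv kˣ), MulAut.mul_apply, ← fib_mul_torusPair hoa hob hab,
    ← fib_mul_torusPair hoa hob hab, pow_two, mul_inv_rev]
  simp only [mul_assoc]

/-- Split `t` into commuting one-coordinate factors. Each lies in a two-dimensional torus as above,
since `m ≥ 2` provides two further coordinates, one of them for the affine chart. -/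
theorem hasLinearLength_torus (hm : 2 ≤ m) (t : Fin (m + 1) → kˣ) :
    HasLinearLength fun n => (torus t : Bir k m) ^ traceSeq n := by
  rw [← Finset.univ_prod_mulSingle t]
  refine Finset.prod_induction _
    (fun t => HasLinearLength fun n => (torus t : Bir k m) ^ traceSeq n) (fun s t hs ht => ?_) ?_
    fun a _ => ?_
  · have hc : Commute (torus s : Bir k m) (torus t) := (Commute.all s t).map torus
    simp only [map_mul, hc.mul_pow]
    exact hs.mul ht
  · simpa using hasLinearLength_const (1 : Bir k m)
  · obtain ⟨b, hba⟩ : ∃ b : Fin (m + 1), b ≠ a :=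
      Fintype.exists_ne_of_one_lt_card (by rw [Fintype.card_fin]; omega) a
    obtain ⟨o, ho⟩ : ∃ o, o ∉ ({a, b} : Finset (Fin (m + 1))) :=
      Finset.exists_mem_notMem_of_card_lt_card (t := Finset.univ)
        (by rw [Finset.card_univ, Fintype.card_fin]
            exact (Finset.card_le_two).trans_lt (by omega)) |>.imp fun _ h => h.2
    simp only [Finset.mem_insert, Finset.mem_singleton, not_or] at ho
    have := hasLinearLength_torusPair ho.1 ho.2 hba.symm (t a, 1)
    rwa [torusPair_apply, Pi.mulSingle_one, mul_one] at this

variable [CharZero k]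

theorem hasLinearLength_unipotent {U : Matrix.GeneralLinearGroup (Fin (m + 1)) k}
    (hU : IsNilpotent (U.1 - 1)) : HasLinearLength fun n => ofGL U ^ traceSeq n := by
  obtain ⟨E, hE⟩ := exists_conj_eq_sq U hU
  refine hasLinearLength_of_conj_eq_sq (x := ofGL E) ?_ traceSeq_lt
  rw [← map_inv, ← map_mul, ← map_mul, hE, map_pow]

/-- The semisimple and unipotent parts commute, but both must be short at the same exponents. The
torus dictates `traceSeq n`, and the unipotent part accepts any sequence of exponential growth. -/
theorem hasLinearLength_ofGL [IsAlgClosed k] (hm : 2 ≤ m)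
    (B : Matrix.GeneralLinearGroup (Fin (m + 1)) k) :
    HasLinearLength fun n => ofGL B ^ traceSeq n := by
  obtain ⟨g, U, D, t, hD, hU, rfl, hc⟩ := exists_diagonal_mul_unipotent B
  have hDt : ofGL D = torus t := congrArg ofGL (Units.ext hD)
  have h : ∀ N : ℕ, ofGL (g * D * g⁻¹ * U) ^ N
      = ofGL g * torus t ^ N * (ofGL g)⁻¹ * ofGL U ^ N := fun N => by
    rw [map_mul, (hc.map ofGL).mul_pow, map_mul, map_mul, map_inv, conj_pow, hDt]
  simp only [h]
  exact ((hasLinearLength_torus hm t).conj _).mul (hasLinearLength_unipotent hU)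

/-- Unipotent matrices are doubly exponentially distorted. -/
theorem hasLinearLength_unipotent_two_pow [IsAlgClosed k] (hm : 2 ≤ m)
    {U : Matrix.GeneralLinearGroup (Fin (m + 1)) k} (hU : IsNilpotent (U.1 - 1)) :
    HasLinearLength fun n => ofGL U ^ 2 ^ traceSeq n := by
  obtain ⟨E, hE⟩ := exists_conj_eq_sq U hU
  have h1 : ∀ n : ℕ, ofGL E ^ n * ofGL U * (ofGL E ^ n)⁻¹ = ofGL U ^ 2 ^ n := by
    intro n
    induction n with
    | zero => simp
    | succ n ih =>
      have h2 : ofGL E * ofGL U * (ofGL E)⁻¹ = ofGL U ^ 2 := by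
        rw [← map_inv, ← map_mul, ← map_mul, hE, map_pow]
      rw [pow_succ' 2 n, pow_mul, ← h2, conj_pow, ← ih, pow_succ']
      group
  -- With exponent `traceSeq n`, the conjugating power of `E` is itself of linear length; nothing is
  -- known about `E` beyond invertibility, hence the need for the bound on all of `GL`.
  simp only [← h1, ← inv_pow, ← map_inv]
  exact ((hasLinearLength_ofGL hm E).mul (hasLinearLength_const _)).mul (hasLinearLength_ofGL hm E⁻¹)

end Lower

end Cremona

theorem mainTheorem2 (k : Type*) [Field k] [IsAlgClosed k] [CharZero k] (m : ℕ) (hm : 2 ≤ m)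
    (A : Matrix.SpecialLinearGroup (Fin (m + 1)) k) (hA : ¬ IsOfFinOrder A) :
    (Cremona.IsVirtuallyUnipotent (A : Matrix (Fin (m + 1)) (Fin (m + 1)) k) →
      Distortion.HasType (Cremona.ofSL A) Distortion.expExpFun) ∧
    (¬ Cremona.IsVirtuallyUnipotent (A : Matrix (Fin (m + 1)) (Fin (m + 1)) k) →
      Distortion.HasType (Cremona.ofSL A) Distortion.expFun) := by
  refine ⟨fun hu => ⟨?_, fun H _ S hS => ?_⟩, fun hu => ⟨?_, fun H _ S hS => ?_⟩⟩
  · obtain ⟨r, hr, hnil⟩ := hu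
    have h := Cremona.hasLinearLength_unipotent_two_pow hm
      (U := Matrix.SpecialLinearGroup.toGL A ^ r) hnil
    simp only [map_pow, Cremona.ofGL_toGL, ← pow_mul] at h
    -- A short power of `A ^ r` is a short power of `A` with an exponent `r ≥ 1` times larger, so
    -- the lower bound passes to `A`.
    refine h.typeAtLeast_expExpFun fun n => ?_
    exact (Nat.pow_le_pow_right two_pos (Distortion.two_pow_le_traceSeq n)).trans
      (Nat.le_mul_of_pos_left _ hr)
  · obtain ⟨R, hR, D, hD, h⟩ := Cremona.exists_le_pow_pow A hA hu hS.finite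
    exact Distortion.dominated_expExpFun hR hD h
  · exact (Cremona.hasLinearLength_ofGL hm (Matrix.SpecialLinearGroup.toGL A)).typeAtLeast_expFun
      Distortion.two_pow_le_traceSeq
  · obtain ⟨B, h⟩ := Cremona.exists_le_pow A hu hS.finite
    exact Distortion.dominated_expFun h
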